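/- Let $k$ be an algebraically closed field of characteristic zero, let $X$ be a normal variety over $k$ (a normal, separated, integral scheme of finite type over $k$) with generic point $\eta$ and function field $K$, and let $\operatorname{Div}(X)$ be its group of Weil divisors, ordered coefficientwise; put $\operatorname{div}(0)=\infty$. For a reflexive coherent sheaf $\mathcal{F}$ on $X$, viewed as a subsheaf of the constant sheaf $\mathcal{F}_\eta$, and $0\neq e\in\mathcal{F}_\eta$, let $\mathcal{W}_{\mathcal F}(e)\in\operatorname{Div}(X)$ be the unique Weil divisor $D$ such that $\mathcal{O}_X(D)\cdot e=(K\cdot e)\cap\mathcal{F}$, where $\mathcal{O}_X(D)(U)=\{f\in K^*\mid (D+\operatorname{div}(f))|_U\geq 0\}\cup\{0\}$ for nonempty open $U\subseteq X$; put $\mathcal{W}_{\mathcal F}(0)=\infty$. This is the Weil decoration of $\mathcal F$. Let $\mathcal{E}$ be a reflexive coherent sheaf on $X$ with dual $\mathcal{E}^\vee=\mathcal{H}om_{\mathcal{O}_X}(\mathcal{E},\mathcal{O}_X)$. Then the divisors defining $\mathcal{W}_{\mathcal{E}}$ and $\mathcal{W}_{\mathcal{E}^\vee}$ exist and are unique,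 there is a canonical isomorphism $(\mathcal{E}^\vee)_\eta\cong(\mathcal{E}_\eta)^\vee$ of $K$-vector spaces (sending the germ of a local homomorphism to the linear form it induces), and under it, for every $\varphi\in(\mathcal{E}_\eta)^\vee$, \[ \mathcal{W}_{\mathcal{E}^\vee}(\varphi)=\bigwedge_{0\neq v\in\mathcal{E}_\eta}\bigl(\operatorname{div}(\varphi(v))-\mathcal{W}_{\mathcal{E}}(v)\bigr), \] the greatest lower bound in $\operatorname{Div}(X)\cup\{\infty\}$. For $\varphi\neq0$ this meet is a well-defined divisor formed coefficientwise: for every prime divisor $P$, the minimum of the integers $\operatorname{div}(\varphi(v))_P-\mathcal{W}_{\mathcal{E}}(v)_P$ over all $v\in\mathcal{E}_\eta$ with $\varphi(v)\neq0$ exists and equals $\mathcal{W}_{\mathcal{E}^\vee}(\varphi)_P$, and it is zero for all but finitely many $P$. -/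

import Mathlib

universe u

open CategoryTheory AlgebraicGeometry

namespace WeilDeco

open TopologicalSpace Opposite

noncomputable section

/-- A normal algebraic variety over the field `k`: an integral, separated scheme of finite type
over `k` all of whose local rings are integrally closed domains. -/
structure NormalVariety (k : Type u) [Field k] where
  X : Scheme.{u}
  str : X ⟶ Spec (CommRingCat.of k)
  isIntegral : IsIntegral X
  isSeparated : IsSeparated str
  locallyOfFiniteType : LocallyOfFiniteType str
  quasiCompact : QuasiCompact str
  isIntegrallyClosed_stalk : ∀ x : X, IsIntegrallyClosed (X.presheaf.stalk x)

namespace NormalVariety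
variable {k : Type u} [Field k] (X : NormalVariety k)

instance : IsIntegral X.X := X.isIntegral

instance : IsNoetherian X.X := by
  have := X.locallyOfFiniteType
  have := X.quasiCompact
  have h1 : IsLocallyNoetherian X.X := LocallyOfFiniteType.isLocallyNoetherian X.str
  have h2 : CompactSpace X.X := QuasiCompact.compactSpace_of_compactSpace X.str
  exact { }

end NormalVariety

/-- Prime divisors of `X`, identified with their generic points, that is, with the points of
codimension one (`Order.coheight` refers to the specialization order on `X`). -/
abbrev PrimeDivisor (X : Scheme.{u}) : Type u := {P : X // Order.coheight P = 1}

/-- The group `Div(X)` of Weil divisors of a Noetherian scheme: finite formal integral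
combinations of prime divisors. It is ordered coefficientwise. -/
abbrev WeilDivisor (X : Scheme.{u}) : Type u := PrimeDivisor X →₀ ℤ

section Divisors

variable {X : Scheme.{u}} [IsIntegral X] [IsNoetherian X]

/-- Only finitely many prime divisors lie in the complement of a nonempty open set. -/
theorem finite_primeDivisor_not_mem (U : X.Opens) (hU : (U : Set X).Nonempty) :
    {P : PrimeDivisor X | P.1 ∉ U}.Finite := by
  have : NoetherianSpace X := inferInstance
  let Z : Set X := (U : Set X)ᶜ
  have hZ : IsClosed Z := U.isOpen.isClosed_compl
  obtain ⟨S, hS, hS'⟩ := NoetherianSpace.exists_finite_set_isClosed_irreducible hZ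
  obtain ⟨hSc, hSi, hSe⟩ := hS'
  have hη : genericPoint X ∈ U :=
    ((genericPoint_spec X).mem_open_set_iff U.isOpen).mpr (by simpa using hU)
  refine Set.Finite.of_finite_image (f := fun P : PrimeDivisor X => closure {P.1}) ?_ ?_
  · refine hS.subset ?_
    rintro _ ⟨P, hP, rfl⟩
    have : P.1 ∈ Z := hP
    rw [hSe] at this
    obtain ⟨T, hT, hPT⟩ := this
    have hTi := hSi T hT
    have hTc := hSc T hT
    obtain ⟨z, hz⟩ := QuasiSober.sober hTi hTc
    have hzP : z ⤳ P.1 := hz.specializes hPT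
    have hzZ : z ∈ Z := by
      rw [hSe]; exact ⟨T, hT, hz.mem⟩
    have hPz : P.1 ⤳ z := by
      by_contra hcon
      have h1 : P.1 < z := lt_of_le_not_ge hzP hcon
      have h2 : z < genericPoint X := by
        refine lt_of_le_not_ge ((genericPoint_spec X).specializes trivial) ?_
        intro h
        have : z ∈ U := h.mem_open U.isOpen hη
        exact hzZ this
      have h3 := Order.coheight_add_one_le h1
      have h4 := Order.coheight_add_one_le h2
      rw [P.2] at h3
      have : (1:ℕ∞) + 1 ≤ 1 := le_trans (by gcongr; exact le_trans (by simp) h4) h3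
      exact absurd this (by decide)
    have : P.1 = z := (hPz.antisymm hzP).eq
    change closure {P.1} ∈ S
    rw [this, hz.def]; exact hT
  · intro P _ Q _ h
    apply Subtype.ext
    exact IsGenericPoint.eq (isGenericPoint_closure) (by rw [IsGenericPoint]; exact h.symm)

theorem finite_support_ord (f : X.functionField) :
    (Function.support fun P : PrimeDivisor X => Scheme.ord f P.1).Finite := by
  by_cases hf : f = 0
  · subst hf; simp [Function.support]
  obtain ⟨U, hU, s, rfl⟩ := X.presheaf.exists_germ_eq f
  have hne : Nonempty U := ⟨⟨_, hU⟩⟩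
  have hs : s ≠ 0 := by rintro rfl; simp at hf
  refine (finite_primeDivisor_not_mem (X.basicOpen s) ?_).subset ?_
  · rw [Set.nonempty_iff_ne_empty]
    intro h
    apply hs
    apply (basicOpen_eq_bot_iff s).mp
    exact SetLike.coe_injective h
  · intro P hP hPU
    apply hP
    have hle := X.basicOpen_le s
    have : Nonempty (X.basicOpen s) := ⟨⟨_, hPU⟩⟩
    have h1 := Scheme.ord_of_isUnit (X := X) (U := X.basicOpen s)
      (f := X.presheaf.map (homOfLE hle).op s)
      (RingedSpace.isUnit_res_basicOpen X.toRingedSpace s) hPU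
    rw [← h1]
    exact congrArg (fun g : X.functionField => Scheme.ord g P.1)
      (X.presheaf.germ_res_apply (homOfLE hle) _ _ s).symm

/-- The divisor `div(f)` of a nonzero rational function (with value `0` at `f = 0`; the convention
`div(0) = ∞` is implemented in `divTop`). -/
def div (f : X.functionField) : WeilDivisor X :=
  Finsupp.ofSupportFinite (fun P => Scheme.ord f P.1) (finite_support_ord f)

/-- `div(f)` as an element of `Div(X) ∪ {∞}`, with `div(0) = ∞`. -/
def divTop (f : X.functionField) : WithTop (WeilDivisor X) :=
  open Classical in if f = 0 then ⊤ else ((div f : WeilDivisor X) : WithTop (WeilDivisor X))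

/-- The sections `𝒪_X(D)(U) = {f ∈ K^* | (D + div(f))|_U ≥ 0} ∪ {0}`. -/
def sectionsOfDivisor (D : WeilDivisor X) (U : X.Opens) : Set X.functionField :=
  {f | f ≠ 0 → ∀ P : PrimeDivisor X, P.1 ∈ U → 0 ≤ (D + div f) P}

end Divisors

section Dual
variable {X : Scheme.{u}} (E : X.Modules)

/-- `Hom_{𝒪_U}(E|_U, 𝒪_U)`: families of `𝒪_X(V)`-linear maps `E(V) → 𝒪_X(V)`, for `V ⊆ U` open,
that are compatible with the restriction maps. -/
def DualSection (U : X.Opens) :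
    AddSubgroup (∀ V : {V : X.Opens // V ≤ U}, Γ(E, V.1) →ₗ[Γ(X, V.1)] Γ(X, V.1)) where
  carrier := {s | ∀ (V W : {V : X.Opens // V ≤ U}) (h : W.1 ≤ V.1) (m : Γ(E, V.1)),
    s W (E.presheaf.map (homOfLE h).op m) = X.presheaf.map (homOfLE h).op (s V m)}
  add_mem' hs ht V W h m := by simp [hs V W h m, ht V W h m]
  zero_mem' V W h m := by simp
  neg_mem' hs V W h m := by simp [hs V W h m]

/-- `𝒪_X(U)` acts on `Hom_{𝒪_U}(E|_U, 𝒪_U)` by restricting and multiplying values. -/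
instance (U : X.Opens) : SMul Γ(X, U) (DualSection E U) where
  smul r s := ⟨fun V => X.presheaf.map (homOfLE V.2).op r • s.1 V, by
    intro V W h m
    have := s.2 V W h m
    simp only [LinearMap.smul_apply, smul_eq_mul, map_mul, this]
    congr 1
    rw [← CommRingCat.comp_apply, ← Functor.map_comp]
    rfl⟩

theorem DualSection.smul_apply {U : X.Opens} (r : Γ(X, U)) (s : DualSection E U)
    (V : {V : X.Opens // V ≤ U}) :
    (r • s).1 V = X.presheaf.map (homOfLE V.2).op r • s.1 V := rfl

instance (U : X.Opens) : Module Γ(X, U) (DualSection E U) where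
  one_smul s := Subtype.ext <| funext fun V => by simp [DualSection.smul_apply]
  mul_smul r t s := Subtype.ext <| funext fun V => by simp [DualSection.smul_apply, mul_smul]
  smul_zero r := Subtype.ext <| funext fun V => by simp [DualSection.smul_apply]
  smul_add r s t := Subtype.ext <| funext fun V => by simp [DualSection.smul_apply]
  add_smul r t s := Subtype.ext <| funext fun V => by simp [DualSection.smul_apply, add_smul]
  zero_smul s := Subtype.ext <| funext fun V => by simp [DualSection.smul_apply]

/-- Restriction of homomorphisms to a smaller open set. -/
def DualSection.restrict {U V : X.Opens} (h : V ≤ U) : DualSection E U →+ DualSection E V where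
  toFun s := ⟨fun W => s.1 ⟨W.1, W.2.trans h⟩, fun W W' h' m =>
    s.2 ⟨W.1, W.2.trans h⟩ ⟨W'.1, W'.2.trans h⟩ h' m⟩
  map_zero' := rfl
  map_add' _ _ := rfl

/-- The presheaf of abelian groups `U ↦ Hom_{𝒪_U}(E|_U, 𝒪_U)`. -/
def dualPresheaf : TopCat.Presheaf Ab.{u} X where
  obj U := AddCommGrpCat.of (DualSection E U.unop)
  map f := AddCommGrpCat.ofHom (DualSection.restrict E f.unop.le)

instance (U : (Opens X)ᵒᵖ) : Module (X.ringCatSheaf.obj.obj U) ((dualPresheaf E).obj U) :=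
  inferInstanceAs (Module Γ(X, U.unop) (DualSection E U.unop))

theorem eq_of_eq_on_cover {ι : Type*} (U : ι → X.Opens) {V : X.Opens} (hV : V ≤ iSup U)
    (x y : Γ(X, V))
    (h : ∀ i, X.presheaf.map (homOfLE (inf_le_left : V ⊓ U i ≤ V)).op x =
      X.presheaf.map (homOfLE (inf_le_left : V ⊓ U i ≤ V)).op y) : x = y :=
  X.sheaf.eq_of_locally_eq' (fun i => V ⊓ U i) V (fun _ => homOfLE inf_le_left)
    (by rw [← inf_iSup_eq]; exact le_inf le_rfl hV) x y h

theorem exists_glue {ι : Type*} (U : ι → X.Opens) (s : ∀ i, DualSection E (U i))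
    (hs : ∀ (i j : ι) (V : X.Opens) (hi : V ≤ U i) (hj : V ≤ U j),
      (s i).1 ⟨V, hi⟩ = (s j).1 ⟨V, hj⟩) {V : X.Opens} (hV : V ≤ iSup U) (m : Γ(E, V)) :
    ∃ x : Γ(X, V), ∀ i, X.presheaf.map (homOfLE (inf_le_left : V ⊓ U i ≤ V)).op x =
      (s i).1 ⟨V ⊓ U i, inf_le_right⟩ (E.presheaf.map (homOfLE inf_le_left).op m) := by
  obtain ⟨x, hx, -⟩ := X.sheaf.existsUnique_gluing' (fun i => V ⊓ U i) V
    (fun _ => homOfLE inf_le_left) (by rw [← inf_iSup_eq]; exact le_inf le_rfl hV)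
    (fun i => (s i).1 ⟨V ⊓ U i, inf_le_right⟩ (E.presheaf.map (homOfLE inf_le_left).op m)) (by
      intro i j
      let W : X.Opens := (V ⊓ U i) ⊓ (V ⊓ U j)
      have hi := (s i).2 ⟨V ⊓ U i, inf_le_right⟩ ⟨W, inf_le_left.trans inf_le_right⟩ inf_le_left
        (E.presheaf.map (homOfLE inf_le_left).op m)
      have hj := (s j).2 ⟨V ⊓ U j, inf_le_right⟩ ⟨W, inf_le_right.trans inf_le_right⟩ inf_le_right
        (E.presheaf.map (homOfLE inf_le_left).op m)
      refine hi.symm.trans (Eq.trans ?_ hj)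
      rw [hs i j W (inf_le_left.trans inf_le_right) (inf_le_right.trans inf_le_right)]
      rw [← ConcreteCategory.comp_apply, ← ConcreteCategory.comp_apply, ← Functor.map_comp,
        ← Functor.map_comp]
      rfl)
  exact ⟨x, hx⟩

theorem exists_glued_section {ι : Type*} (U : ι → X.Opens) (s : ∀ i, DualSection E (U i))
    (hs : ∀ (i j : ι) (V : X.Opens) (hi : V ≤ U i) (hj : V ≤ U j),
      (s i).1 ⟨V, hi⟩ = (s j).1 ⟨V, hj⟩) :
    ∃ t : DualSection E (iSup U), ∀ i, DualSection.restrict E (le_iSup U i) t = s i := by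
  choose g hg using fun (V : {V : X.Opens // V ≤ iSup U}) (m : Γ(E, V.1)) =>
    exists_glue E U s hs V.2 m
  refine ⟨⟨fun V =>
    { toFun := g V
      map_add' := fun m m' => eq_of_eq_on_cover U V.2 _ _ fun i => by
        simp only [map_add, hg]
      map_smul' := fun r m => eq_of_eq_on_cover U V.2 _ _ fun i => by
        simp only [map_mul, hg, smul_eq_mul, RingHom.id_apply, Scheme.Modules.map_smul,
          map_smul] }, ?_⟩, ?_⟩
  · intro V W h m
    refine eq_of_eq_on_cover U W.2 _ _ fun i => ?_
    refine (hg W _ i).trans ?_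
    have h1 := (s i).2 ⟨V.1 ⊓ U i, inf_le_right⟩ ⟨W.1 ⊓ U i, inf_le_right⟩
      (inf_le_inf_right _ h) (E.presheaf.map (homOfLE inf_le_left).op m)
    rw [← hg V m i] at h1
    rw [← ConcreteCategory.comp_apply, ← Functor.map_comp] at h1 ⊢
    refine h1.trans ?_
    change X.presheaf.map _ _ = X.presheaf.map _ (X.presheaf.map _ (g V m))
    rw [← CommRingCat.comp_apply, ← CommRingCat.comp_apply, ← Functor.map_comp,
      ← Functor.map_comp]
    rfl
  · intro i
    refine Subtype.ext <| funext fun V => LinearMap.ext fun m => ?_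
    refine eq_of_eq_on_cover U (V.2.trans (le_iSup U i)) _ _ fun j => ?_
    refine (hg ⟨V.1, V.2.trans (le_iSup U i)⟩ m j).trans ?_
    rw [hs j i (V.1 ⊓ U j) inf_le_right (inf_le_left.trans V.2)]
    exact (s i).2 V ⟨V.1 ⊓ U j, inf_le_left.trans V.2⟩ inf_le_left m

theorem dualPresheaf_isSheaf : (dualPresheaf E).IsSheaf := by
  rw [TopCat.Presheaf.isSheaf_iff_isSheafUniqueGluing]
  intro ι U s hs
  obtain ⟨t, ht⟩ := exists_glued_section E U s (fun i j V hi hj =>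
    congrArg (fun q : DualSection E (U i ⊓ U j) => q.1 ⟨V, le_inf hi hj⟩) (hs i j))
  refine ⟨t, ht, fun t' ht' => ?_⟩
  refine Subtype.ext <| funext fun V => LinearMap.ext fun m => ?_
  refine eq_of_eq_on_cover U V.2 _ _ fun i => ?_
  have h1 := Subtype.prop (show DualSection E (iSup U) from t') V
    ⟨V.1 ⊓ U i, inf_le_left.trans V.2⟩ inf_le_left m
  have h2 := t.2 V ⟨V.1 ⊓ U i, inf_le_left.trans V.2⟩ inf_le_left m
  refine h1.symm.trans (Eq.trans ?_ h2)
  have h3 : DualSection.restrict E (le_iSup U i) t' = DualSection.restrict E (le_iSup U i) t :=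
    (ht' i).trans (ht i).symm
  exact congrArg (fun q : DualSection E (U i) => q.1 ⟨V.1 ⊓ U i, inf_le_right⟩
    (E.presheaf.map (homOfLE inf_le_left).op m)) h3

theorem DualSection.restrict_smul {U V : X.Opens} (h : V ≤ U) (r : Γ(X, U))
    (s : DualSection E U) :
    restrict E h (r • s) = X.presheaf.map (homOfLE h).op r • restrict E h s := by
  refine Subtype.ext <| funext fun W => ?_
  rw [DualSection.smul_apply, ← CommRingCat.comp_apply, ← Functor.map_comp]
  rfl

/-- The dual sheaf `E^∨ = ℋom_{𝒪_X}(E, 𝒪_X)`. -/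
def dual : X.Modules where
  val := PresheafOfModules.ofPresheaf (R := X.ringCatSheaf.obj) (dualPresheaf E)
    fun _ _ f r s => DualSection.restrict_smul E f.unop.le r s
  isSheaf := dualPresheaf_isSheaf E

/-- The `𝒪_X(V)`-linear map `E(V) → 𝒪_X(V)` given by a section `s` of `E^∨` over `U ⊇ V`. -/
def pairing {U : X.Opens} (s : Γ(dual E, U)) {V : X.Opens} (h : V ≤ U) :
    Γ(E, V) →ₗ[Γ(X, V)] Γ(X, V) :=
  (show DualSection E U from s).1 ⟨V, h⟩

/-- Evaluation at a section `m` of `E` over `U`, as a section of `E^∨^∨` over `U`. -/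
def evaluation {U : X.Opens} (m : Γ(E, U)) : DualSection (dual E) U where
  val V :=
    { toFun := fun s => pairing E s le_rfl (E.presheaf.map (homOfLE V.2).op m)
      map_add' := fun _ _ => rfl
      map_smul' := fun r s => by
        change X.presheaf.map (homOfLE le_rfl).op r • pairing E s le_rfl _ = _
        have : (homOfLE (le_refl V.1)).op = 𝟙 (op V.1) := rfl
        rw [this, X.presheaf.map_id]
        rfl }
  property V W h s := by
    change pairing E s h _ = X.presheaf.map (homOfLE h).op (pairing E s le_rfl _)
    refine Eq.trans ?_ ((show DualSection E V.1 from s).2 ⟨V.1, le_rfl⟩ ⟨W.1, h⟩ h _)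
    change pairing E s h _ = pairing E s h _
    rw [← ConcreteCategory.comp_apply, ← Functor.map_comp]
    rfl

theorem evaluation_add {U : X.Opens} (m m' : Γ(E, U)) :
    evaluation E (m + m') = evaluation E m + evaluation E m' := by
  refine Subtype.ext <| funext fun V => LinearMap.ext fun s => ?_
  change pairing E s le_rfl _ = pairing E s le_rfl _ + pairing E s le_rfl _
  rw [map_add, map_add]

theorem evaluation_smul {U : X.Opens} (r : Γ(X, U)) (m : Γ(E, U)) :
    evaluation E (r • m) = r • evaluation E m := by
  refine Subtype.ext <| funext fun V => LinearMap.ext fun s => ?_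
  change pairing E s le_rfl _ = X.presheaf.map (homOfLE V.2).op r • pairing E s le_rfl _
  rw [Scheme.Modules.map_smul, map_smul]

theorem evaluation_restrict {U V : X.Opens} (h : V ≤ U) (m : Γ(E, U)) :
    evaluation E (E.presheaf.map (homOfLE h).op m) =
      DualSection.restrict (dual E) h (evaluation E m) := by
  refine Subtype.ext <| funext fun W => LinearMap.ext fun s => ?_
  change pairing E s le_rfl _ = pairing E s le_rfl _
  rw [← ConcreteCategory.comp_apply, ← Functor.map_comp]
  rfl

/-- The natural morphism `E ⟶ E^∨^∨`. -/
def toDoubleDual : E ⟶ dual (dual E) :=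
  SheafOfModules.Hom.mk (PresheafOfModules.homMk
    { app U := AddCommGrpCat.ofHom
        (AddMonoidHom.mk' (fun m : Γ(E, U.unop) => evaluation E m) (evaluation_add E))
      naturality U V f := by
        ext m
        exact evaluation_restrict E f.unop.le m }
    fun U r m => evaluation_smul E (U := U.unop) r m)

/-- `E` is reflexive if the natural morphism into its double dual is an isomorphism. -/
def IsReflexive : Prop := IsIso (toDoubleDual E)

/-- Coherent sheaves on a (locally) Noetherian scheme: quasi-coherent sheaves whose sections over
every affine open set form a finitely generated module. -/
def IsCoherent : Prop :=
  E.IsQuasicoherent ∧ ∀ U : X.Opens, IsAffineOpen U → Module.Finite Γ(X, U) Γ(E, U)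

end Dual

section Decoration

variable {X : Scheme.{u}} [IsIntegral X]

/-- The generic stalk `E_η`. -/
abbrev genericStalk (E : X.Modules) : Type u :=
  (TopCat.Presheaf.stalk (C := Ab.{u}) (X := X.toTopCat) E.val.presheaf (genericPoint X) : Ab.{u})

/-- The generic stalk is a vector space over the function field, with
`(germ r) • (germ m) = germ (r • m)`; see `germ_smul` below. -/
instance (E : X.Modules) : Module X.functionField (genericStalk E) :=
  PresheafOfModules.instModuleCarrierStalkCommRingCatCarrierAbPresheafOpensCarrier
    (R := X.presheaf) E.val (genericPoint X)

/-- The map `E(U) → E_η` from sections over a (nonempty) open set to the generic stalk. -/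
def germ (E : X.Modules) {U : X.Opens} (hU : genericPoint X ∈ U) : Γ(E, U) →+ genericStalk E :=
  (TopCat.Presheaf.germ (C := Ab.{u}) (X := X.toTopCat) E.val.presheaf U (genericPoint X) hU).hom

theorem germ_smul (E : X.Modules) {U : X.Opens} (hU : genericPoint X ∈ U) (r : Γ(X, U))
    (m : Γ(E, U)) :
    germ E hU (r • m) = X.presheaf.germ U (genericPoint X) hU r • germ E hU m :=
  PresheafOfModules.germ_smul (R := X.presheaf) E.val (genericPoint X) U hU r m

/-- The sections over `U` of the subsheaf `(1/e) ⋅ ((K ⋅ e) ∩ E)` of `K`: the rational functions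
`f` for which `f ⋅ e` lies in (the image in `E_η` of) `E(U)`. -/
def lineSections (E : X.Modules) (e : genericStalk E) {U : X.Opens} (hU : genericPoint X ∈ U) :
    Set X.functionField :=
  {f | f • e ∈ Set.range (germ E hU)}

variable [IsNoetherian X]

/-- `D` satisfies `𝒪_X(D) ⋅ e = (K ⋅ e) ∩ E`. -/
def IsDivisorOf (E : X.Modules) (e : genericStalk E) (D : WeilDivisor X) : Prop :=
  ∀ (U : X.Opens) (hU : genericPoint X ∈ U), sectionsOfDivisor D U = lineSections E e hU

/-- The divisor `D(e)` with `𝒪_X(D(e)) ⋅ e = (K ⋅ e) ∩ E`, for `e ≠ 0`. (It is unique if it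
exists, and it exists if `E` is reflexive and `X` is a normal variety.) -/
def divisorOf (E : X.Modules) (e : genericStalk E) : WeilDivisor X :=
  Classical.epsilon (IsDivisorOf E e)

/-- The Weil decoration `W_E : E_η → Div(X) ∪ {∞}`, with `W_E(e) = D(e)` for `e ≠ 0` and
`W_E(0) = ∞`. -/
def weilDecoration (E : X.Modules) (e : genericStalk E) : WithTop (WeilDivisor X) :=
  open Classical in
  if e = 0 then ⊤ else ((divisorOf E e : WeilDivisor X) : WithTop (WeilDivisor X))

/-- The canonical isomorphism `(E^∨)_η ≅ (E_η)^∨` is the one which sends the germ of a section `s`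
of `E^∨` to the linear form induced by `s` on germs of sections of `E`. Since every element of a
stalk is a germ, there is at most one such `c`. -/
def IsCanonicalDualIso (E : X.Modules)
    (c : genericStalk (dual E) ≃ₗ[X.functionField] Module.Dual X.functionField (genericStalk E)) :
    Prop :=
  ∀ (U V : X.Opens) (hU : genericPoint X ∈ U) (hV : genericPoint X ∈ V) (h : V ≤ U)
    (s : Γ(dual E, U)) (m : Γ(E, V)),
    c (germ (dual E) hU s) (germ E hV m) =
      X.presheaf.germ V (genericPoint X) hV (pairing E s h m)

/-- The differences `div(φ(v)) - W_E(v)` in `Div(X) ∪ {∞}`, for `0 ≠ v ∈ E_η`. -/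
def dualDifferences (E : X.Modules) (φ : Module.Dual X.functionField (genericStalk E)) :
    Set (WithTop (WeilDivisor X)) :=
  {D | ∃ v : genericStalk E, v ≠ 0 ∧
    D = divTop (φ v) + ((-divisorOf E v : WeilDivisor X) : WithTop (WeilDivisor X))}

end Decoration

end

end WeilDeco

open WeilDeco

/-! Everything takes place inside the `K`-vector space `E_η` and its dual. At a prime divisor `P`
the local ring is a discrete valuation ring, and `W_F(e)_P` is the integer `n` such that `f • e`
lies in the image `F_P` of the stalk exactly when `n + ord_P f ≥ 0`
(`smul_mem_stalkAt_iff_of_isDivisorOf`). The formula is therefore a statement about lattices in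
codimension one. By coherence, `(E^∨)_P` consists of the linear forms with regular values on `E_P`
(`exists_mem_stalkAt_dual_iff`), so `f • φ` lies in it if and only if `ord_P f + ord_P φ(v) ≥ 0` for
all `v ∈ E_P`. Rescaling each `v` to a generator of `(K ⋅ v) ∩ E_P` turns this bound into the
minimum of `ord_P φ(v) - W_E(v)_P` (`isLeast_divisorOf_dual`).

The divisors exist because membership in codimension one suffices. For functions this is the Hartogs
property of normal schemes (`exists_germ_eq_of_forall_primeDivisor`). It passes to `E^∨`, whose
sections are the forms with regular values, and then to `E`, which reflexivity identifies with
`E^∨^∨`. Almost all coefficients vanish: on some nonempty open set both `e` and a form with value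
`1` at `e` are integral (`exists_isDivisorOf`). -/

namespace WeilDeco

open TopologicalSpace Opposite

noncomputable section

/-! ### Commutative algebra behind the Hartogs property. -/

section Algebra

/-- Let `m` be the maximal ideal. If `m g` contains a unit `r g`, then `r` generates `m`. Otherwise
`m g ⊆ m`, and since `m` is finitely generated and nonzero, `g` is integral over `B`, hence in `B`:
a contradiction. -/
theorem isDiscreteValuationRing_of_smul_maximalIdeal {B K : Type*} [CommRing B] [IsDomain B]
    [IsNoetherianRing B] [IsLocalRing B] [IsIntegrallyClosed B] [Field K] [Algebra B K]
    [IsFractionRing B K] (g : K) (hg : g ∉ (algebraMap B K).range)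
    (h : ∀ r ∈ IsLocalRing.maximalIdeal B, algebraMap B K r * g ∈ (algebraMap B K).range) :
    IsDiscreteValuationRing B := by
  have hinj : Function.Injective (algebraMap B K) := IsFractionRing.injective B K
  have hB : ¬ IsField B := fun hB =>
    hg ((IsFractionRing.surjective_iff_isField (R := B) (K := K)).mpr hB g)
  have hg0 : g ≠ 0 := by
    rintro rfl
    exact hg (zero_mem _)
  refine ((IsDiscreteValuationRing.TFAE B hB).out 0 4).mpr ?_
  by_cases hu : ∃ r ∈ IsLocalRing.maximalIdeal B, ∃ b : B, IsUnit b ∧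
      algebraMap B K b = algebraMap B K r * g
  · obtain ⟨r, hr, b, hb, hrb⟩ := hu
    refine ⟨⟨r, le_antisymm (fun x hx => ?_) ?_⟩⟩
    · obtain ⟨y, hy⟩ := h x hx
      obtain ⟨c, hc⟩ := hb.exists_right_inv
      refine Submodule.mem_span_singleton.mpr ⟨y * c, hinj ?_⟩
      have hc' : algebraMap B K b * algebraMap B K c = 1 := by rw [← map_mul, hc, map_one]
      rw [smul_eq_mul, map_mul, map_mul, hy]
      rw [hrb] at hc'
      linear_combination algebraMap B K x * hc'
    · rwa [Submodule.span_singleton_le_iff_mem]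
  · exfalso
    push Not at hu
    have hint : _root_.IsIntegral B g := by
      refine isIntegral_of_smul_mem_submodule
        (Submodule.map (Algebra.linearMap B K) (IsLocalRing.maximalIdeal B)) ?_ ?_ g ?_
      · intro h0
        refine hB (IsLocalRing.isField_iff_maximalIdeal_eq.mpr ?_)
        rw [eq_bot_iff]
        intro r hr
        have : algebraMap B K r ∈ (⊥ : Submodule B K) := h0 ▸ ⟨r, hr, rfl⟩
        simpa using this
      · exact (IsNoetherian.noetherian (IsLocalRing.maximalIdeal B)).map _
      · rintro _ ⟨r, hr, rfl⟩
        obtain ⟨b, hb⟩ := h r hr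
        refine ⟨b, ?_, ?_⟩
        · by_contra hbu
          refine hu r hr b ?_ hb
          simpa using hbu
        · simp only [Algebra.linearMap_apply, hb, smul_eq_mul, mul_comm]
    exact hg (IsIntegrallyClosed.isIntegral_iff.mp hint)

/-- Write `f = a / b`. The class of `a` in `A / (b)` is nonzero, so the submodule it generates has
an associated prime, the annihilator of some `c a`. An element `r` kills `c a` modulo `b` exactly
when `r c f ∈ A`. -/
theorem exists_prime_eq_denominators {A K : Type*} [CommRing A] [IsDomain A] [IsNoetherianRing A]
    [Field K] [Algebra A K] [IsFractionRing A K] (f : K) (hf : f ∉ (algebraMap A K).range) :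
    ∃ (p : Ideal A) (c : A), p.IsPrime ∧
      ∀ r : A, r ∈ p ↔ algebraMap A K r * (algebraMap A K c * f) ∈ (algebraMap A K).range := by
  obtain ⟨b, hb0, a, hab⟩ : ∃ b : A, b ≠ 0 ∧ ∃ a : A, algebraMap A K b * f = algebraMap A K a := by
    obtain ⟨a, b, hb, rfl⟩ := IsFractionRing.div_surjective (A := A) f
    have : algebraMap A K b ≠ 0 := by
      simpa using nonZeroDivisors.ne_zero hb
    exact ⟨b, nonZeroDivisors.ne_zero hb, a, by field_simp⟩
  have hinj : Function.Injective (algebraMap A K) := IsFractionRing.injective A K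
  have hbK : algebraMap A K b ≠ 0 := by simpa using hb0
  have key : ∀ x : A, b ∣ x * a ↔ algebraMap A K x * f ∈ (algebraMap A K).range := by
    intro x
    constructor
    · rintro ⟨y, hy⟩
      refine ⟨y, mul_left_cancel₀ hbK ?_⟩
      rw [← map_mul, ← hy, map_mul, ← hab]
      ring
    · rintro ⟨y, hy⟩
      refine ⟨y, hinj ?_⟩
      rw [map_mul, map_mul, hy, ← hab]
      ring
  have ha : (Ideal.Quotient.mk (Ideal.span {b}) a) ≠ 0 := by
    intro h0
    rw [Ideal.Quotient.eq_zero_iff_mem, Ideal.mem_span_singleton] at h0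
    apply hf
    simpa using (key 1).mp (by simpa using h0)
  obtain ⟨c, hc⟩ : ∃ c : A, (Ideal.span {b} : Ideal A).colon {c * a} |>.IsPrime := by
    let M : Submodule A (A ⧸ Ideal.span {b}) :=
      Submodule.span A {Ideal.Quotient.mk (Ideal.span {b}) a}
    obtain ⟨p, hp, -⟩ := exists_le_isAssociatedPrime_of_isNoetherianRing A
      (⟨Ideal.Quotient.mk (Ideal.span {b}) a, Submodule.mem_span_singleton_self _⟩ : M)
      (fun h => ha (congrArg Subtype.val h))
    rw [isAssociatedPrime_iff] at hp
    obtain ⟨hp, ⟨y, hy⟩, rfl⟩ := hp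
    obtain ⟨c, rfl⟩ := Submodule.mem_span_singleton.mp hy
    refine ⟨c, ?_⟩
    convert hp using 1
    ext r
    simp only [Submodule.mem_colon_singleton, Submodule.mem_bot]
    rw [← SetLike.coe_eq_coe]
    change _ ↔ r • c • Ideal.Quotient.mk (Ideal.span {b}) a = 0
    rw [← Ideal.Quotient.eq_zero_iff_mem]
    simp [Algebra.smul_def]
  refine ⟨_, c, hc, fun r => ?_⟩
  rw [Submodule.mem_colon_singleton, Ideal.mem_span_singleton, smul_eq_mul, ← mul_assoc, key,
    map_mul, mul_assoc]

end Algebra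

/-! ### Order of vanishing over a discrete valuation ring. -/

section Ord

theorem one_le_ordFrac_iff {R K : Type*} [CommRing R] [IsDomain R] [IsDiscreteValuationRing R]
    [Field K] [Algebra R K] [IsFractionRing R K] [Ring.KrullDimLE 1 R] {f : K} (hf : f ≠ 0) :
    1 ≤ Ring.ordFrac R f ↔ f ∈ (algebraMap R K).range := by
  constructor
  · intro h
    rw [Ring.ordFrac_eq_valuation_inv] at h
    have h1 : (IsDiscreteValuationRing.maximalIdeal R).valuation K f ≤ 1 := by
      rwa [one_le_inv₀] at h
      simpa [WithZero.pos_iff_ne_zero] using hf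
    exact IsDiscreteValuationRing.exists_lift_of_le_one h1
  · rintro ⟨x, rfl⟩
    exact Ring.ordFrac_ge_one_of_ne_zero (by rintro rfl; simp at hf)

end Ord

/-! ### Local rings as subrings of the function field. -/

section Regular

variable {X : Scheme.{u}} [IsIntegral X]

theorem genericPoint_mem {U : X.Opens} {x : X} (hx : x ∈ U) : genericPoint X ∈ U :=
  (genericPoint_specializes x).mem_open U.isOpen hx

/-- The local ring at `x`, as a subring of the function field. -/
def regularAt (x : X) : Subring X.functionField :=
  (algebraMap (X.presheaf.stalk x) X.functionField).range

theorem algebraMap_germ {U : X.Opens} {x : X} (hx : x ∈ U) (s : Γ(X, U)) :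
    algebraMap (X.presheaf.stalk x) X.functionField (X.presheaf.germ U x hx s) =
      X.presheaf.germ U (genericPoint X) (genericPoint_mem hx) s := by
  have : Nonempty U := ⟨⟨x, hx⟩⟩
  exact Scheme.algebraMap_germ_eq_germToFunctionField X hx s

theorem mem_regularAt_iff {x : X} {f : X.functionField} :
    f ∈ regularAt x ↔ ∃ (U : X.Opens) (hx : x ∈ U) (s : Γ(X, U)),
      X.presheaf.germ U (genericPoint X) (genericPoint_mem hx) s = f := by
  constructor
  · rintro ⟨a, rfl⟩
    obtain ⟨U, hx, s, rfl⟩ := X.presheaf.exists_germ_eq a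
    exact ⟨U, hx, s, (algebraMap_germ hx s).symm⟩
  · rintro ⟨U, hx, s, rfl⟩
    exact ⟨X.presheaf.germ U x hx s, algebraMap_germ hx s⟩

theorem germ_mem_regularAt {U : X.Opens} (hU : genericPoint X ∈ U) {x : X} (hx : x ∈ U)
    (s : Γ(X, U)) : X.presheaf.germ U (genericPoint X) hU s ∈ regularAt x :=
  mem_regularAt_iff.mpr ⟨U, hx, s, rfl⟩

theorem germ_genericPoint_injective {U : X.Opens} (hU : genericPoint X ∈ U) :
    Function.Injective (X.presheaf.germ U (genericPoint X) hU) :=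
  germ_injective_of_isIntegral X (genericPoint X) hU

theorem exists_open_regular {x : X} {f : X.functionField} (h : f ∈ regularAt x) :
    ∃ U : X.Opens, x ∈ U ∧ ∀ y ∈ U, f ∈ regularAt y := by
  obtain ⟨U, hx, s, rfl⟩ := mem_regularAt_iff.mp h
  exact ⟨U, hx, fun y hy => germ_mem_regularAt _ hy s⟩

theorem mem_regularAt_genericPoint (f : X.functionField) : f ∈ regularAt (genericPoint X) := by
  obtain ⟨U, hU, s, rfl⟩ := X.presheaf.exists_germ_eq f
  exact germ_mem_regularAt hU hU s

/-- A rational function that is regular at every point of `U` is a section over `U`. -/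
theorem exists_germ_eq_of_forall_regularAt {U : X.Opens} (hU : genericPoint X ∈ U)
    {f : X.functionField} (h : ∀ x ∈ U, f ∈ regularAt x) :
    ∃ s : Γ(X, U), X.presheaf.germ U (genericPoint X) hU s = f := by
  choose V hxV s hs using fun x : U => mem_regularAt_iff.mp (h x.1 x.2)
  let W : U → X.Opens := fun x => V x ⊓ U
  have hxW : ∀ x : U, x.1 ∈ W x := fun x => ⟨hxV x, x.2⟩
  obtain ⟨t, ht, -⟩ := X.sheaf.existsUnique_gluing' W U (fun x => homOfLE inf_le_right)
    (fun x hx => Opens.mem_iSup.mpr ⟨⟨x, hx⟩, hxW ⟨x, hx⟩⟩)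
    (fun x => X.presheaf.map (homOfLE inf_le_left : W x ⟶ V x).op (s x)) (by
      intro x y
      -- The overlap contains the generic point, so agreement can be tested on generic germs, and
      -- both equal `f`.
      have hxy : genericPoint X ∈ W x ⊓ W y :=
        ⟨genericPoint_mem (hxW x), genericPoint_mem (hxW y)⟩
      apply germ_genericPoint_injective hxy
      refine (X.presheaf.germ_res_apply _ _ _ _).trans ?_
      refine (X.presheaf.germ_res_apply _ _ _ _).trans ?_
      refine Eq.trans ?_ (X.presheaf.germ_res_apply _ _ _ _).symm
      refine Eq.trans ?_ (X.presheaf.germ_res_apply _ _ _ _).symm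
      exact (hs x).trans (hs y).symm)
  refine ⟨t, ?_⟩
  let η : U := ⟨genericPoint X, hU⟩
  have h1 := congrArg (X.presheaf.germ (W η) (genericPoint X) (hxW η)) (ht η)
  refine Eq.trans ?_ (h1.trans ?_)
  · exact (X.presheaf.germ_res_apply _ _ _ _).symm
  · exact (X.presheaf.germ_res_apply _ _ _ _).trans (hs η)

end Regular

/-! ### Valuations in codimension one and the Hartogs property for functions. -/

section Hartogs

variable {X : Scheme.{u}} [IsIntegral X] [IsNoetherian X]
  (hX : ∀ x : X, IsIntegrallyClosed (X.presheaf.stalk x))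

include hX in
theorem isDiscreteValuationRing_stalk (P : PrimeDivisor X) :
    IsDiscreteValuationRing (X.presheaf.stalk P.1) := by
  have := hX P.1
  have hd : ringKrullDim (X.presheaf.stalk P.1) = 1 := by
    rw [ringKrullDim_stalk_eq_coheight, P.2]; rfl
  have hle : Ring.KrullDimLE 1 (X.presheaf.stalk P.1) := krullDimLE_of_coheight_le P.2.le
  have : Ring.DimensionLEOne (X.presheaf.stalk P.1) :=
    ⟨fun {p} hp0 hp => Ring.krullDimLE_one_iff_of_noZeroDivisors.mp hle p hp0 hp⟩
  have : IsDedekindRing (X.presheaf.stalk P.1) := { }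
  exact ((IsDiscreteValuationRing.TFAE _
    (ringKrullDim_eq_one_iff_of_isLocalRing_isDomain.mp hd).1).out 0 2).mpr
    (@IsDedekindDomain.mk _ _ inferInstance this)

include hX in
theorem mem_regularAt_iff_ord_nonneg (P : PrimeDivisor X) {f : X.functionField} (hf : f ≠ 0) :
    f ∈ regularAt P.1 ↔ 0 ≤ Scheme.ord f P.1 := by
  have := isDiscreteValuationRing_stalk hX P
  have hle : Ring.KrullDimLE 1 (X.presheaf.stalk P.1) := krullDimLE_of_coheight_le P.2.le
  rw [Scheme.le_ord_iff P.2 hf]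
  exact (one_le_ordFrac_iff hf).symm

include hX in
-- Powers of a uniformizer. They are the test functions from which coefficients of divisors are read
-- off below.
theorem exists_ord_eq (P : PrimeDivisor X) (n : ℤ) :
    ∃ f : X.functionField, f ≠ 0 ∧ Scheme.ord f P.1 = n := by
  have := isDiscreteValuationRing_stalk hX P
  have hle : Ring.KrullDimLE 1 (X.presheaf.stalk P.1) := krullDimLE_of_coheight_le P.2.le
  obtain ⟨ϖ, hϖ⟩ := IsDiscreteValuationRing.exists_irreducible (X.presheaf.stalk P.1)
  have h0 : algebraMap (X.presheaf.stalk P.1) X.functionField ϖ ≠ 0 := by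
    simpa using hϖ.ne_zero
  refine ⟨algebraMap _ X.functionField ϖ ^ n, zpow_ne_zero _ h0, ?_⟩
  rw [Scheme.ord_eq_iff P.2 (zpow_ne_zero _ h0), map_zpow₀]
  have h1 : Scheme.ordHom P.1 P.2 (algebraMap (X.presheaf.stalk P.1) X.functionField ϖ) =
    WithZero.exp 1 := Ring.ordFrac_irreducible hϖ
  rw [h1, ← WithZero.exp_zsmul]
  simp [WithZero.exp]

include hX in
-- If `f` is not a section, some multiple `g = c f` has a prime ideal `p` of denominators. In the
-- local ring at `p`, the function `g` is still not regular while its products with the maximal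
-- ideal are, so this ring is a discrete valuation ring and `p` is a point of codimension one, where
-- `f` is regular by hypothesis.
theorem exists_germ_eq_of_isAffineOpen {U : X.Opens} (hU : IsAffineOpen U)
    (hη : genericPoint X ∈ U) {f : X.functionField}
    (h : ∀ P : PrimeDivisor X, P.1 ∈ U → f ∈ regularAt P.1) :
    ∃ s : Γ(X, U), X.presheaf.germ U (genericPoint X) hη s = f := by
  have : Nonempty U := ⟨⟨_, hη⟩⟩
  have : IsFractionRing Γ(X, U) X.functionField := 
    functionField_isFractionRing_of_isAffineOpen X U hU
  have : IsNoetherianRing Γ(X, U) := IsLocallyNoetherian.component_noetherian ⟨U, hU⟩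
  by_contra hf
  obtain ⟨p, c, hp, hpc⟩ := exists_prime_eq_denominators (A := Γ(X, U)) f
    (fun ⟨s, hs⟩ => hf ⟨s, hs⟩)
  let g : X.functionField := algebraMap Γ(X, U) X.functionField c * f
  let P : X := hU.fromSpec ⟨p, hp⟩
  have hPU : P ∈ U := by
    have h2 : P ∈ Set.range hU.fromSpec := ⟨_, rfl⟩
    rwa [hU.range_fromSpec] at h2
  let alg := X.presheaf.algebra_section_stalk ⟨P, hPU⟩
  have hloc : IsLocalization.AtPrime (X.presheaf.stalk P) p := hU.isLocalization_stalk' ⟨p, hp⟩ hPU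
  have hmap : ∀ a : Γ(X, U), algebraMap Γ(X, U) (X.presheaf.stalk P) a =
    X.presheaf.germ U P hPU a := fun _ => rfl
  have hmapK : ∀ a : Γ(X, U), algebraMap (X.presheaf.stalk P) X.functionField
      (algebraMap Γ(X, U) (X.presheaf.stalk P) a) = algebraMap Γ(X, U) X.functionField a :=
    fun a => algebraMap_germ hPU a
  have hg : g ∉ regularAt P := by
    rintro ⟨z, hz⟩
    obtain ⟨⟨a, s⟩, has⟩ := IsLocalization.surj p.primeCompl z
    refine s.2 ((hpc s.1).mpr ⟨a, ?_⟩)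
    have := congrArg (algebraMap (X.presheaf.stalk P) X.functionField) has
    rw [map_mul, hmapK, hmapK, hz] at this
    rw [← this, mul_comm]
  have := hX P
  have hdvr : IsDiscreteValuationRing (X.presheaf.stalk P) := by
    refine isDiscreteValuationRing_of_smul_maximalIdeal g hg fun r hr => ?_
    obtain ⟨a, s, rfl⟩ := IsLocalization.exists_mk'_eq p.primeCompl r
    have ha : a ∈ p := (IsLocalization.AtPrime.mk'_mem_maximal_iff _ p a s).mp hr
    obtain ⟨b, hb⟩ := (hpc a).mp ha
    refine ⟨IsLocalization.mk' _ b s, ?_⟩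
    have hs : algebraMap Γ(X, U) X.functionField s.1 ≠ 0 := by
      rw [← hmapK]
      simpa using (IsLocalization.map_units (X.presheaf.stalk P) s).ne_zero
    apply mul_left_cancel₀ hs
    rw [← mul_assoc, ← hmapK, ← map_mul, ← map_mul, IsLocalization.mk'_spec',
      IsLocalization.mk'_spec', hmapK, hmapK]
    exact hb
  have hd : Order.coheight P = 1 := by
    have := IsDiscreteValuationRing.ringKrullDim_eq_one (X.presheaf.stalk P)
    rw [ringKrullDim_stalk_eq_coheight] at this
    exact_mod_cast this
  -- Both `c` and `f` are regular at `P`, hence so is `g = c f`.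
  refine hg ((regularAt P).mul_mem ?_ (h ⟨P, hd⟩ hPU))
  exact ⟨_, hmapK c⟩

include hX in
/-- A rational function that is regular in codimension one is regular. -/
theorem exists_germ_eq_of_forall_primeDivisor {U : X.Opens} (hη : genericPoint X ∈ U)
    {f : X.functionField} (h : ∀ P : PrimeDivisor X, P.1 ∈ U → f ∈ regularAt P.1) :
    ∃ s : Γ(X, U), X.presheaf.germ U (genericPoint X) hη s = f := by
  refine exists_germ_eq_of_forall_regularAt hη fun x hx => ?_
  obtain ⟨_, ⟨V, hV, rfl⟩, hxV, hVU⟩ := X.isBasis_affineOpens.exists_subset_of_mem_open hx U.isOpen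
  obtain ⟨s, rfl⟩ := exists_germ_eq_of_isAffineOpen hX hV (genericPoint_mem hxV)
    fun P hP => h P (hVU hP)
  exact germ_mem_regularAt _ hxV s

end Hartogs

/-! ### Sections of the dual sheaf as linear forms on the generic stalk. -/

section Germs

variable {X : Scheme.{u}} (E : X.Modules)

theorem pairing_res {U V W : X.Opens} (s : Γ(dual E, U)) (hV : V ≤ U) (hWV : W ≤ V) (m : Γ(E, V)) :
    pairing E s (hWV.trans hV) (E.presheaf.map (homOfLE hWV).op m) =
      X.presheaf.map (homOfLE hWV).op (pairing E s hV m) :=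
  (show DualSection E U from s).2 ⟨V, hV⟩ ⟨W, hWV.trans hV⟩ hWV m

theorem pairing_res_left {U V W : X.Opens} (s : Γ(dual E, U)) (hV : V ≤ U) (hWV : W ≤ V)
    (m : Γ(E, W)) :
    pairing E ((dual E).presheaf.map (homOfLE hV).op s) hWV m = pairing E s (hWV.trans hV) m :=
  rfl

variable [IsIntegral X]

theorem germ_res {U V : X.Opens} (h : V ≤ U) (hV : genericPoint X ∈ V) (m : Γ(E, U)) :
    germ E hV (E.presheaf.map (homOfLE h).op m) = germ E (h hV) m :=
  TopCat.Presheaf.germ_res_apply (C := Ab.{u}) (X := X.toTopCat) E.val.presheaf (homOfLE h)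
    (genericPoint X) hV m

theorem exists_germ_eq (e : genericStalk E) :
    ∃ (U : X.Opens) (hU : genericPoint X ∈ U) (m : Γ(E, U)), germ E hU m = e :=
  TopCat.Presheaf.exists_germ_eq (C := Ab.{u}) (X := X.toTopCat) E.val.presheaf e

theorem exists_germ_eq_of_le {U : X.Opens} (hU : genericPoint X ∈ U) (e : genericStalk E) :
    ∃ (V : X.Opens) (_ : V ≤ U) (hV : genericPoint X ∈ V) (m : Γ(E, V)), germ E hV m = e := by
  obtain ⟨V, hV, m, rfl⟩ := exists_germ_eq E e
  exact ⟨U ⊓ V, inf_le_left, ⟨hU, hV⟩, _, germ_res E inf_le_right ⟨hU, hV⟩ m⟩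

theorem germ_eq {U V : X.Opens} (hU : genericPoint X ∈ U) (hV : genericPoint X ∈ V)
    {m : Γ(E, U)} {n : Γ(E, V)} (h : germ E hU m = germ E hV n) :
    ∃ (W : X.Opens) (_ : genericPoint X ∈ W) (hWU : W ≤ U) (hWV : W ≤ V),
      E.presheaf.map (homOfLE hWU).op m = E.presheaf.map (homOfLE hWV).op n := by
  obtain ⟨W, hW, iU, iV, h'⟩ := TopCat.Presheaf.germ_eq (C := Ab.{u}) (X := X.toTopCat)
    E.val.presheaf (genericPoint X) hU hV m n h
  exact ⟨W, hW, iU.le, iV.le, h'⟩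

theorem structureSheaf_germ_res {U V : X.Opens} (h : V ≤ U) (hV : genericPoint X ∈ V)
    (r : Γ(X, U)) :
    X.presheaf.germ V (genericPoint X) hV (X.presheaf.map (homOfLE h).op r) =
      X.presheaf.germ U (genericPoint X) (h hV) r :=
  X.presheaf.germ_res_apply (homOfLE h) (genericPoint X) hV r

theorem germ_pairing_congr {U V V' : X.Opens} (s : Γ(dual E, U)) (hV : V ≤ U) (hV' : V' ≤ U)
    (hη : genericPoint X ∈ V) (hη' : genericPoint X ∈ V') {m : Γ(E, V)} {m' : Γ(E, V')}
    (h : germ E hη m = germ E hη' m') :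
    X.presheaf.germ V (genericPoint X) hη (pairing E s hV m) =
      X.presheaf.germ V' (genericPoint X) hη' (pairing E s hV' m') := by
  obtain ⟨W, hW, hWV, hWV', h⟩ := germ_eq E hη hη' h
  rw [← structureSheaf_germ_res hWV hW, ← structureSheaf_germ_res hWV' hW, ← pairing_res,
    ← pairing_res, h]

theorem exists_inducedForm {U : X.Opens} (hU : genericPoint X ∈ U) (s : Γ(dual E, U)) :
    ∃ φ : Module.Dual X.functionField (genericStalk E),
      ∀ (V : X.Opens) (hVU : V ≤ U) (hV : genericPoint X ∈ V) (m : Γ(E, V)),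
        φ (germ E hV m) = X.presheaf.germ V (genericPoint X) hV (pairing E s hVU m) := by
  choose V hVU hV m hm using exists_germ_eq_of_le E hU
  let φ : genericStalk E → X.functionField := fun e =>
    X.presheaf.germ (V e) (genericPoint X) (hV e) (pairing E s (hVU e) (m e))
  have hφ : ∀ (V : X.Opens) (hVU : V ≤ U) (hV : genericPoint X ∈ V) (m : Γ(E, V)),
      φ (germ E hV m) = X.presheaf.germ V (genericPoint X) hV (pairing E s hVU m) :=
    fun W hWU hW n => germ_pairing_congr E s _ _ _ _ (hm _)
  refine ⟨{ toFun := φ, map_add' := ?_, map_smul' := ?_ }, hφ⟩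
  · intro e e'
    let W := V e ⊓ V e'
    have hW : genericPoint X ∈ W := ⟨hV e, hV e'⟩
    have hWU : W ≤ U := inf_le_left.trans (hVU e)
    obtain ⟨n, hn⟩ : ∃ n : Γ(E, W), germ E hW n = e := ⟨_, (germ_res E inf_le_left hW _).trans (hm e)⟩
    obtain ⟨n', hn'⟩ : ∃ n : Γ(E, W), germ E hW n = e' :=
      ⟨_, (germ_res E inf_le_right hW _).trans (hm e')⟩
    rw [← hn, ← hn', ← map_add, hφ W hWU, hφ W hWU, hφ W hWU, map_add, map_add]
  · intro f e
    obtain ⟨W', hW', r, rfl⟩ := X.presheaf.exists_germ_eq f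
    let W := V e ⊓ W'
    have hW : genericPoint X ∈ W := ⟨hV e, hW'⟩
    have hWU : W ≤ U := inf_le_left.trans (hVU e)
    obtain ⟨n, hn⟩ : ∃ n : Γ(E, W), germ E hW n = e := ⟨_, (germ_res E inf_le_left hW _).trans (hm e)⟩
    rw [← hn, ← structureSheaf_germ_res (inf_le_right : W ≤ W') hW r, ← germ_smul, hφ W hWU,
      hφ W hWU, map_smul, smul_eq_mul, map_mul]
    rfl

/-- The linear form on the generic stalk of `E` induced by a section of the dual sheaf. -/
def inducedForm {U : X.Opens} (hU : genericPoint X ∈ U) (s : Γ(dual E, U)) :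
    Module.Dual X.functionField (genericStalk E) :=
  (exists_inducedForm E hU s).choose

theorem inducedForm_germ {U V : X.Opens} (hU : genericPoint X ∈ U) (s : Γ(dual E, U))
    (hVU : V ≤ U) (hV : genericPoint X ∈ V) (m : Γ(E, V)) :
    inducedForm E hU s (germ E hV m) =
      X.presheaf.germ V (genericPoint X) hV (pairing E s hVU m) :=
  (exists_inducedForm E hU s).choose_spec V hVU hV m

theorem inducedForm_res {U V : X.Opens} (h : V ≤ U) (hV : genericPoint X ∈ V) (s : Γ(dual E, U)) :
    inducedForm E hV ((dual E).presheaf.map (homOfLE h).op s) = inducedForm E (h hV) s := by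
  refine LinearMap.ext fun e => ?_
  obtain ⟨W, hWV, hW, m, rfl⟩ := exists_germ_eq_of_le E hV e
  rw [inducedForm_germ E hV _ hWV, inducedForm_germ E (h hV) _ (hWV.trans h), pairing_res_left]

theorem inducedForm_congr {U V : X.Opens} (hU : genericPoint X ∈ U) (hV : genericPoint X ∈ V)
    {s : Γ(dual E, U)} {t : Γ(dual E, V)} (h : germ (dual E) hU s = germ (dual E) hV t) :
    inducedForm E hU s = inducedForm E hV t := by
  obtain ⟨W, hW, hWU, hWV, h⟩ := germ_eq (dual E) hU hV h
  rw [← inducedForm_res E hWU hW, ← inducedForm_res E hWV hW, h]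

/-- A section of the dual is determined by its values, and these embed in `K` over every nonempty
open set. An open set missing the generic point is empty, and its ring of functions is trivial. -/
theorem inducedForm_injective {U : X.Opens} (hU : genericPoint X ∈ U) :
    Function.Injective (inducedForm E hU) := by
  intro s t h
  change (show DualSection E U from s) = (show DualSection E U from t)
  refine Subtype.ext <| funext fun V => LinearMap.ext fun m => ?_
  change pairing E s V.2 m = pairing E t V.2 m
  by_cases hV : genericPoint X ∈ V.1
  · apply germ_genericPoint_injective hV
    rw [← inducedForm_germ E hU s V.2 hV, ← inducedForm_germ E hU t V.2 hV, h]
  · have hbot : V.1 = ⊥ := by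
      rw [eq_bot_iff]
      exact fun x hx => hV (genericPoint_mem hx)
    have : Subsingleton Γ(X, V.1) := by
      rw [hbot]
      infer_instance
    exact Subsingleton.elim _ _

theorem exists_canonicalDualMap :
    ∃ c : genericStalk (dual E) →ₗ[X.functionField] Module.Dual X.functionField (genericStalk E),
      ∀ (U : X.Opens) (hU : genericPoint X ∈ U) (s : Γ(dual E, U)),
        c (germ (dual E) hU s) = inducedForm E hU s := by
  choose U hU s hs using exists_germ_eq (dual E)
  let c : genericStalk (dual E) → Module.Dual X.functionField (genericStalk E) := fun ψ =>
    inducedForm E (hU ψ) (s ψ)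
  have hc : ∀ (U : X.Opens) (hU : genericPoint X ∈ U) (s : Γ(dual E, U)),
      c (germ (dual E) hU s) = inducedForm E hU s :=
    fun V hV t => inducedForm_congr E _ _ (hs _)
  refine ⟨{ toFun := c, map_add' := ?_, map_smul' := ?_ }, hc⟩
  · intro ψ ψ'
    let W := U ψ ⊓ U ψ'
    have hW : genericPoint X ∈ W := ⟨hU ψ, hU ψ'⟩
    obtain ⟨t, ht⟩ : ∃ t : Γ(dual E, W), germ (dual E) hW t = ψ :=
      ⟨_, (germ_res (dual E) inf_le_left hW _).trans (hs ψ)⟩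
    obtain ⟨t', ht'⟩ : ∃ t : Γ(dual E, W), germ (dual E) hW t = ψ' :=
      ⟨_, (germ_res (dual E) inf_le_right hW _).trans (hs ψ')⟩
    rw [← ht, ← ht', ← map_add, hc, hc, hc]
    refine LinearMap.ext fun e => ?_
    obtain ⟨V, hVW, hV, m, rfl⟩ := exists_germ_eq_of_le E hW e
    rw [LinearMap.add_apply, inducedForm_germ E hW _ hVW, inducedForm_germ E hW _ hVW,
      inducedForm_germ E hW _ hVW, ← map_add]
    rfl
  · intro f ψ
    obtain ⟨W', hW', r, rfl⟩ := X.presheaf.exists_germ_eq f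
    let W := U ψ ⊓ W'
    have hW : genericPoint X ∈ W := ⟨hU ψ, hW'⟩
    obtain ⟨t, ht⟩ : ∃ t : Γ(dual E, W), germ (dual E) hW t = ψ :=
      ⟨_, (germ_res (dual E) inf_le_left hW _).trans (hs ψ)⟩
    rw [← ht, ← structureSheaf_germ_res (inf_le_right : W ≤ W') hW r, ← germ_smul, hc, hc]
    refine LinearMap.ext fun e => ?_
    obtain ⟨V, hVW, hV, m, rfl⟩ := exists_germ_eq_of_le E hW e
    rw [RingHom.id_apply, LinearMap.smul_apply, inducedForm_germ E hW _ hVW,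
      inducedForm_germ E hW _ hVW, smul_eq_mul, ← structureSheaf_germ_res hVW hV, ← map_mul]
    rfl

/-- The canonical map from the generic stalk of the dual sheaf to the dual of the generic stalk. -/
def canonicalDualMap :
    genericStalk (dual E) →ₗ[X.functionField] Module.Dual X.functionField (genericStalk E) :=
  (exists_canonicalDualMap E).choose

theorem canonicalDualMap_germ {U : X.Opens} (hU : genericPoint X ∈ U) (s : Γ(dual E, U)) :
    canonicalDualMap E (germ (dual E) hU s) = inducedForm E hU s :=
  (exists_canonicalDualMap E).choose_spec U hU s

theorem canonicalDualMap_injective : Function.Injective (canonicalDualMap E) := by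
  rw [injective_iff_map_eq_zero]
  intro ψ h
  obtain ⟨U, hU, s, rfl⟩ := exists_germ_eq (dual E) ψ
  rw [canonicalDualMap_germ] at h
  have h0 : inducedForm E hU 0 = 0 := by
    rw [← canonicalDualMap_germ, map_zero, map_zero]
  rw [inducedForm_injective E hU (h.trans h0.symm), map_zero]

/-- A linear form on the generic stalk which maps sections of `E` over open subsets of `U` to
regular functions is induced by a section of the dual sheaf. -/
theorem exists_inducedForm_eq {U : X.Opens} (hU : genericPoint X ∈ U)
    (φ : Module.Dual X.functionField (genericStalk E))
    (h : ∀ (V : X.Opens) (_ : V ≤ U) (hV : genericPoint X ∈ V) (m : Γ(E, V)),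
      ∃ r : Γ(X, V), X.presheaf.germ V (genericPoint X) hV r = φ (germ E hV m)) :
    ∃ s : Γ(dual E, U), inducedForm E hU s = φ := by
  classical
  choose r hr using h
  -- The `else` branch concerns only the empty open set, where `0` is the only map.
  let s : DualSection E U := ⟨fun V => if hV : genericPoint X ∈ V.1 then
      { toFun := r V.1 V.2 hV
        map_add' := fun m m' => germ_genericPoint_injective hV (by
          rw [map_add, hr, hr, hr, map_add, map_add])
        map_smul' := fun a m => germ_genericPoint_injective hV (by
          rw [RingHom.id_apply, smul_eq_mul, map_mul, hr, hr, germ_smul, map_smul, smul_eq_mul]) }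
    else 0, by
      intro V W h m
      by_cases hW : genericPoint X ∈ W.1
      · have hV : genericPoint X ∈ V.1 := h hW
        simp only [hV, hW, dite_true]
        apply germ_genericPoint_injective hW
        rw [structureSheaf_germ_res h hW]
        change X.presheaf.germ _ _ _ (r W.1 W.2 hW _) = X.presheaf.germ _ _ _ (r V.1 V.2 hV m)
        rw [hr, hr, germ_res]
      · have hbot : W.1 = ⊥ := by
          rw [eq_bot_iff]
          exact fun x hx => hW (genericPoint_mem hx)
        have : Subsingleton Γ(X, W.1) := by
          rw [hbot]
          infer_instance
        exact Subsingleton.elim _ _⟩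
  refine ⟨s, LinearMap.ext fun e => ?_⟩
  obtain ⟨V, hVU, hV, m, rfl⟩ := exists_germ_eq_of_le E hU e
  refine (inducedForm_germ E hU (show Γ(dual E, U) from s) hVU hV m).trans ?_
  rw [← hr V hVU hV m]
  congr 1
  change s.1 ⟨V, hVU⟩ m = _
  simp only [s, hV, dite_true]
  rfl

end Germs

/-! ### Quasi-coherence: extending sections after clearing denominators. -/

section Coherent

/-- For a quasi-coherent module, sections over `D(f)` are the localization of the global sections at
the powers of `f`. -/
theorem exists_pow_smul_eq_res {R : CommRingCat.{u}} (M : (Spec R).Modules) [M.IsQuasicoherent]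
    (f : R) (W : (Spec R).Opens) (hW : W = PrimeSpectrum.basicOpen f) (s : Γ(M, W)) :
    ∃ (n : ℕ) (t : Γ(M, ⊤)),
      M.presheaf.map (homOfLE (le_top : W ≤ ⊤)).op t = (f ^ n : R) • s := by
  subst hW
  have h := (isIso_fromTildeΓ_iff_isLocalizing M).mp inferInstance f
  obtain ⟨⟨t, ⟨_, n, rfl⟩⟩, ht⟩ := h.surj s
  exact ⟨n, t, ht.symm⟩

variable {X : Scheme.{u}} (E : X.Modules)

/-- Scalars act on `E.restrict hU.fromSpec` through `appIso`. This identifies their action with that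
of restricted functions on `X`, so that the result on `Spec` transfers to `U`. -/
theorem fromSpec_appIso_inv {U : X.Opens} (hU : IsAffineOpen U) (W : (Spec Γ(X, U)).Opens)
    (h : hU.fromSpec ''ᵁ W ≤ U) (r : Γ(X, U)) :
    (hU.fromSpec.appIso W).inv ((Spec Γ(X, U)).presheaf.map W.leTop.op
      ((Scheme.ΓSpecIso Γ(X, U)).inv r)) = X.presheaf.map (homOfLE h).op r := by
  have e : W ≤ hU.fromSpec ⁻¹ᵁ U := by simp
  have h1 := Scheme.Hom.appLE_appIso_inv hU.fromSpec e
  have h2 : hU.fromSpec.appLE U W e =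
      (Scheme.ΓSpecIso Γ(X, U)).inv ≫ (Spec Γ(X, U)).presheaf.map W.leTop.op := by
    rw [Scheme.Hom.appLE, hU.fromSpec_app_self, Category.assoc, ← Functor.map_comp]
    rfl
  rw [h2] at h1
  exact congrArg (fun g : Γ(X, U) ⟶ Γ(X, hU.fromSpec ''ᵁ W) => g r) h1

theorem exists_pow_smul_eq_res_of_isAffineOpen [E.IsQuasicoherent] {U : X.Opens}
    (hU : IsAffineOpen U) (f : Γ(X, U)) (V : X.Opens) (hV : V = X.basicOpen f) (hVU : V ≤ U)
    (s : Γ(E, V)) :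
    ∃ (n : ℕ) (t : Γ(E, U)),
      E.presheaf.map (homOfLE hVU).op t = X.presheaf.map (homOfLE hVU).op (f ^ n) • s := by
  let W : (Spec Γ(X, U)).Opens := PrimeSpectrum.basicOpen f
  obtain rfl : V = hU.fromSpec ''ᵁ W := hV.trans (hU.fromSpec_image_basicOpen f).symm
  obtain ⟨n, t, ht⟩ := exists_pow_smul_eq_res (E.restrict hU.fromSpec) f W rfl s
  have hT : U = hU.fromSpec ''ᵁ ⊤ := by simp
  refine ⟨n, E.presheaf.map (homOfLE hT.le).op t, ?_⟩
  rw [← fromSpec_appIso_inv hU W hVU (f ^ n)]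
  refine Eq.trans ?_ ht
  exact (congrArg (fun g : Γ(E, hU.fromSpec ''ᵁ ⊤) ⟶ Γ(E, hU.fromSpec ''ᵁ W) => g t)
    (E.presheaf.map_comp (homOfLE hT.le).op (homOfLE hVU).op)).symm

variable [IsIntegral X]

/-- Sections of a coherent sheaf over a smaller open set are, locally, fractions of sections over
a given affine open set. -/
theorem exists_smul_germ_eq [E.IsQuasicoherent] {U V : X.Opens} (hU : IsAffineOpen U) (hVU : V ≤ U)
    (hη : genericPoint X ∈ V) (m : Γ(E, V)) {x : X} (hx : x ∈ V) :
    ∃ (f : Γ(X, U)) (t : Γ(E, U)),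
      (X.presheaf.germ U (genericPoint X) (hVU hη) f)⁻¹ ∈ regularAt x ∧
      X.presheaf.germ U (genericPoint X) (hVU hη) f ≠ 0 ∧
      germ E (hVU hη) t = X.presheaf.germ U (genericPoint X) (hVU hη) f • germ E hη m := by
  obtain ⟨f, hfV, hxf⟩ := hU.exists_basicOpen_le ⟨x, hx⟩ (hVU hx)
  have hηf : genericPoint X ∈ X.basicOpen f := genericPoint_mem hxf
  obtain ⟨n, t, ht⟩ := exists_pow_smul_eq_res_of_isAffineOpen E hU f _ rfl (X.basicOpen_le f)
    (E.presheaf.map (homOfLE hfV).op m)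
  have ht' := congrArg (germ E hηf) ht
  rw [germ_res, germ_smul, germ_res, structureSheaf_germ_res] at ht'
  have hu : ∀ n : ℕ, IsUnit (X.presheaf.germ U x (hVU hx) (f ^ n)) := fun n => by
    rw [map_pow]
    exact ((X.mem_basicOpen f x (hVU hx)).mp hxf).pow n
  refine ⟨f ^ n, t, ?_, ?_, ht'⟩
  · obtain ⟨b, hb⟩ := (hu n).exists_right_inv
    refine ⟨b, eq_inv_of_mul_eq_one_right ?_⟩
    rw [← algebraMap_germ (hVU hx), ← map_mul, hb, map_one]
  · rw [← algebraMap_germ (hVU hx)]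
    simpa using (hu n).ne_zero

end Coherent

/-! ### Stalks inside the generic stalk, and the stalks of the dual. -/

section StalkAt

theorem exists_finset_generators {X : Scheme.{u}} {E : X.Modules} (hE : IsCoherent E) (x : X) :
    ∃ (U : X.Opens) (_ : IsAffineOpen U) (_ : x ∈ U) (S : Finset Γ(E, U)),
      Submodule.span Γ(X, U) (S : Set Γ(E, U)) = ⊤ := by
  obtain ⟨_, ⟨U, hU, rfl⟩, hxU, -⟩ :=
    X.isBasis_affineOpens.exists_subset_of_mem_open (Set.mem_univ x) isOpen_univ
  obtain ⟨S, hS⟩ := (hE.2 U hU).fg_top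
  exact ⟨U, hU, hxU, S, hS⟩

variable {X : Scheme.{u}} [IsIntegral X] (E : X.Modules)

/-- The image of the stalk of `E` at `x` in the generic stalk. -/
def stalkAt (x : X) : Set (genericStalk E) :=
  {e | ∃ (U : X.Opens) (hx : x ∈ U) (m : Γ(E, U)), germ E (genericPoint_mem hx) m = e}

variable {E}

theorem germ_mem_stalkAt {U : X.Opens} (hU : genericPoint X ∈ U) {x : X} (hx : x ∈ U)
    (m : Γ(E, U)) : germ E hU m ∈ stalkAt E x :=
  ⟨U, hx, m, rfl⟩

theorem smul_mem_stalkAt {x : X} {f : X.functionField} {e : genericStalk E}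
    (hf : f ∈ regularAt x) (he : e ∈ stalkAt E x) : f • e ∈ stalkAt E x := by
  obtain ⟨U, hU, r, rfl⟩ := mem_regularAt_iff.mp hf
  obtain ⟨V, hV, m, rfl⟩ := he
  have hx : x ∈ U ⊓ V := ⟨hU, hV⟩
  refine ⟨U ⊓ V, hx, X.presheaf.map (homOfLE (inf_le_left : U ⊓ V ≤ U)).op r •
    E.presheaf.map (homOfLE (inf_le_right : U ⊓ V ≤ V)).op m, ?_⟩
  rw [germ_smul, germ_res, structureSheaf_germ_res]

theorem canonicalDualMap_apply_mem_regularAt {x : X} {ψ : genericStalk (dual E)}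
    {e : genericStalk E} (hψ : ψ ∈ stalkAt (dual E) x) (he : e ∈ stalkAt E x) :
    canonicalDualMap E ψ e ∈ regularAt x := by
  obtain ⟨U, hU, s, rfl⟩ := hψ
  obtain ⟨V, hV, m, rfl⟩ := he
  have hx : x ∈ U ⊓ V := ⟨hU, hV⟩
  have hη := genericPoint_mem hx
  rw [canonicalDualMap_germ, ← germ_res E (inf_le_right : U ⊓ V ≤ V) hη,
    inducedForm_germ E (genericPoint_mem hU) s (inf_le_left : U ⊓ V ≤ U) hη]
  exact germ_mem_regularAt _ hx _

theorem exists_open_mem_stalkAt {x : X} {e : genericStalk E} (he : e ∈ stalkAt E x) :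
    ∃ U : X.Opens, x ∈ U ∧ ∀ y ∈ U, e ∈ stalkAt E y := by
  obtain ⟨U, hU, m, rfl⟩ := he
  exact ⟨U, hU, fun y hy => germ_mem_stalkAt _ hy m⟩

theorem mem_stalkAt_genericPoint (e : genericStalk E) : e ∈ stalkAt E (genericPoint X) := by
  obtain ⟨U, hU, m, rfl⟩ := exists_germ_eq E e
  exact germ_mem_stalkAt hU hU m

theorem exists_finset_isOpen_regular {x : X} (S : Finset X.functionField)
    (h : ∀ f ∈ S, f ∈ regularAt x) :
    ∃ U : X.Opens, x ∈ U ∧ ∀ y ∈ U, ∀ f ∈ S, f ∈ regularAt y := by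
  classical
  induction S using Finset.induction_on with
  | empty => exact ⟨⊤, trivial, by simp⟩
  | insert f S _ ih =>
    obtain ⟨U, hU, hUS⟩ := ih fun g hg => h g (Finset.mem_insert_of_mem hg)
    obtain ⟨V, hV, hVf⟩ := exists_open_regular (h f (Finset.mem_insert_self f S))
    refine ⟨U ⊓ V, ⟨hU, hV⟩, fun y hy g hg => ?_⟩
    obtain rfl | hg := Finset.mem_insert.mp hg
    · exact hVf y hy.2
    · exact hUS y hy.1 g hg

variable (hE : IsCoherent E)
include hE

theorem exists_smul_mem_stalkAt (x : X) (e : genericStalk E) :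
    ∃ r : X.functionField, r ≠ 0 ∧ r • e ∈ stalkAt E x := by
  have := hE.1
  obtain ⟨_, ⟨U, hU, rfl⟩, hxU, -⟩ :=
    X.isBasis_affineOpens.exists_subset_of_mem_open (Set.mem_univ x) isOpen_univ
  obtain ⟨V, hVU, hV, m, rfl⟩ := exists_germ_eq_of_le E (genericPoint_mem hxU) e
  -- The fraction is taken at the generic point, not at `x`: the denominator only has to be nonzero.
  obtain ⟨f, t, -, hf, ht⟩ := exists_smul_germ_eq E hU hVU hV m hV
  exact ⟨_, hf, ht ▸ germ_mem_stalkAt _ hxU t⟩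

/-- Finiteness spreads regularity out: the finitely many values on generators are regular on a
common neighbourhood of `x`. Sections over smaller open sets are locally fractions of sections over
`U` with invertible denominators, so `φ` has regular values on them too. -/
theorem exists_dual_of_generators {U : X.Opens} (hU : IsAffineOpen U) {x : X} (hx : x ∈ U)
    (S : Finset Γ(E, U)) (hS : Submodule.span Γ(X, U) (S : Set Γ(E, U)) = ⊤)
    (φ : Module.Dual X.functionField (genericStalk E))
    (hφ : ∀ m ∈ S, φ (germ E (genericPoint_mem hx) m) ∈ regularAt x) :
    ∃ ψ ∈ stalkAt (dual E) x, canonicalDualMap E ψ = φ := by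
  classical
  have := hE.1
  have hη := genericPoint_mem hx
  obtain ⟨W, hxW, hW⟩ := exists_finset_isOpen_regular (x := x)
    (S.image fun m => φ (germ E hη m)) (by simpa using hφ)
  have hxW' : x ∈ W ⊓ U := ⟨hxW, hx⟩
  have hgen : ∀ y ∈ W ⊓ U, ∀ t : Γ(E, U), φ (germ E hη t) ∈ regularAt y := by
    intro y hy t
    have ht : t ∈ Submodule.span Γ(X, U) (S : Set Γ(E, U)) := hS ▸ Submodule.mem_top
    induction ht using Submodule.span_induction with
    | mem m hm => exact hW y hy.1 _ (Finset.mem_image_of_mem _ hm)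
    | zero => simp [zero_mem]
    | add a b _ _ ha hb =>
      rw [map_add, map_add]
      exact add_mem ha hb
    | smul r a _ ha =>
      rw [germ_smul, map_smul, smul_eq_mul]
      exact mul_mem (germ_mem_regularAt _ hy.2 r) ha
  obtain ⟨s, hs⟩ := exists_inducedForm_eq E (genericPoint_mem hxW') φ (by
    intro V hV hηV m
    refine exists_germ_eq_of_forall_regularAt hηV fun y hy => ?_
    obtain ⟨f, t, hf, hf0, ht⟩ := exists_smul_germ_eq E hU (hV.trans inf_le_right) hηV m hy
    have h1 := congrArg φ ht
    rw [map_smul, smul_eq_mul] at h1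
    rw [← inv_mul_cancel_left₀ hf0 (φ (germ E hηV m)), ← h1]
    exact mul_mem hf (hgen y (hV hy) t))
  exact ⟨_, germ_mem_stalkAt (genericPoint_mem hxW') hxW' s,
    (canonicalDualMap_germ E _ s).trans hs⟩

/-- The stalk of the dual sheaf consists of the linear forms with regular values on the stalk. -/
theorem exists_mem_stalkAt_dual_iff {x : X} (φ : Module.Dual X.functionField (genericStalk E)) :
    (∃ ψ ∈ stalkAt (dual E) x, canonicalDualMap E ψ = φ) ↔
      ∀ e ∈ stalkAt E x, φ e ∈ regularAt x := by
  constructor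
  · rintro ⟨ψ, hψ, rfl⟩ e he
    exact canonicalDualMap_apply_mem_regularAt hψ he
  · intro h
    obtain ⟨U, hU, hx, S, hS⟩ := exists_finset_generators hE x
    exact exists_dual_of_generators hE hU hx S hS φ fun m _ => h _ (germ_mem_stalkAt _ hx m)

/-- The multiplier is a common denominator of the values of `φ` on finitely many generators. -/
theorem exists_smul_dual_mem_stalkAt (x : X) (φ : Module.Dual X.functionField (genericStalk E)) :
    ∃ r : X.functionField, r ≠ 0 ∧ ∃ ψ ∈ stalkAt (dual E) x, canonicalDualMap E ψ = r • φ := by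
  classical
  obtain ⟨U, hU, hx, S, hS⟩ := exists_finset_generators hE x
  obtain ⟨b, hb⟩ := IsLocalization.exist_integer_multiples_of_finset
    (nonZeroDivisors (X.presheaf.stalk x)) (S.image fun m => φ (germ E (genericPoint_mem hx) m))
  refine ⟨algebraMap (X.presheaf.stalk x) X.functionField b, by
    simp, exists_dual_of_generators hE hU hx S hS _ ?_⟩
  intro m hm
  obtain ⟨a, ha⟩ := hb _ (Finset.mem_image_of_mem _ hm)
  refine ⟨a, ha.trans ?_⟩
  rw [LinearMap.smul_apply, Algebra.smul_def, smul_eq_mul]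

theorem canonicalDualMap_bijective : Function.Bijective (canonicalDualMap E) := by
  refine ⟨canonicalDualMap_injective E, fun φ => ?_⟩
  -- At the generic point every rational function is regular, so the condition on `φ` is empty.
  obtain ⟨ψ, -, hψ⟩ := (exists_mem_stalkAt_dual_iff hE (x := genericPoint X) φ).mpr
    fun e _ => mem_regularAt_genericPoint _
  exact ⟨ψ, hψ⟩

end StalkAt

/-! ### The Hartogs property for dual and reflexive sheaves. -/

section HartogsModules

variable {X : Scheme.{u}} [IsIntegral X] [IsNoetherian X]
  (hX : ∀ x : X, IsIntegrallyClosed (X.presheaf.stalk x)) {E : X.Modules}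
include hX

/-- The values of `ψ` on sections of `E` are regular in codimension one, hence regular. -/
theorem exists_germ_dual_eq_of_forall_primeDivisor {U : X.Opens} (hU : genericPoint X ∈ U)
    {ψ : genericStalk (dual E)} (h : ∀ P : PrimeDivisor X, P.1 ∈ U → ψ ∈ stalkAt (dual E) P.1) :
    ∃ s : Γ(dual E, U), germ (dual E) hU s = ψ := by
  obtain ⟨s, hs⟩ := exists_inducedForm_eq E hU (canonicalDualMap E ψ) fun V hVU hV m =>
    exists_germ_eq_of_forall_primeDivisor hX hV fun P hP =>
      canonicalDualMap_apply_mem_regularAt (h P (hVU hP)) (germ_mem_stalkAt hV hP m)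
  exact ⟨s, canonicalDualMap_injective E ((canonicalDualMap_germ E hU s).trans hs)⟩

theorem exists_germ_eq_of_forall_primeDivisor_of_isReflexive (hE : IsCoherent E)
    (hrefl : IsReflexive E) {U : X.Opens} (hU : genericPoint X ∈ U)
    {e : genericStalk E} (h : ∀ P : PrimeDivisor X, P.1 ∈ U → e ∈ stalkAt E P.1) :
    ∃ m : Γ(E, U), germ E hU m = e := by
  -- Evaluation at `e`. It comes from a section of `E^∨^∨` over `U`, which reflexivity turns into a
  -- section `m` of `E`.
  let φ : Module.Dual X.functionField (genericStalk (dual E)) :=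
    (LinearMap.applyₗ e).comp (canonicalDualMap E)
  obtain ⟨s, hs⟩ := exists_inducedForm_eq (dual E) hU φ fun V hVU hV t =>
    exists_germ_eq_of_forall_primeDivisor hX hV fun P hP =>
      canonicalDualMap_apply_mem_regularAt (germ_mem_stalkAt hV hP t) (h P (hVU hP))
  have : IsIso (toDoubleDual E) := hrefl
  have hbij : Function.Bijective ((toDoubleDual E).app U) :=
    ConcreteCategory.bijective_of_isIso ((toDoubleDual E).app U)
  obtain ⟨m, hm⟩ := hbij.2 s
  refine ⟨m, ?_⟩
  -- Linear forms separate the vectors of `E_η`, and each comes from `E^∨`, so it is enough that `e`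
  -- and the germ of `m` pair equally with `E^∨`.
  rw [← sub_eq_zero]
  by_contra hne
  obtain ⟨χ, hχ⟩ := Module.Projective.exists_dual_eq_one X.functionField hne
  obtain ⟨ψ, rfl⟩ := (canonicalDualMap_bijective hE).2 χ
  obtain ⟨V, hVU, hV, t, rfl⟩ := exists_germ_eq_of_le (dual E) hU ψ
  have h1 : canonicalDualMap E (germ (dual E) hV t) e =
      canonicalDualMap E (germ (dual E) hV t) (germ E hU m) := by
    have h2 := congrArg (fun φ => φ (germ (dual E) hV t)) hs
    simp only [← hm] at h2
    rw [inducedForm_germ (dual E) hU _ hVU hV] at h2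
    refine h2.symm.trans ?_
    rw [canonicalDualMap_germ, ← germ_res E hVU hV, inducedForm_germ E hV t le_rfl hV]
    rfl
  rw [map_sub, h1, sub_self] at hχ
  exact zero_ne_one hχ

end HartogsModules

/-! ### Existence and uniqueness of the divisor of a vector. -/

section Divisors

/-- Distinct points of codimension one do not specialize to one another, so the finite union of the
closures of the points of `S` misses `P`. -/
theorem exists_open_primeDivisor_not_mem {X : Scheme.{u}} (P : PrimeDivisor X) {S : Set (PrimeDivisor X)}
    (hS : S.Finite) (hP : P ∉ S) : ∃ U : X.Opens, P.1 ∈ U ∧ ∀ Q ∈ S, Q.1 ∉ U := by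
  refine ⟨⟨(⋃ Q ∈ S, closure {Q.1})ᶜ,
    (hS.isClosed_biUnion fun Q _ => isClosed_closure).isOpen_compl⟩, ?_, fun Q hQ h => ?_⟩
  · intro h
    obtain ⟨Q, hQ, hPQ⟩ := Set.mem_iUnion₂.mp h
    have hspec : Q.1 ⤳ P.1 := specializes_iff_mem_closure.mpr hPQ
    have hPQ' : P.1 ⤳ Q.1 := by
      by_contra hcon
      have h1 : P.1 < Q.1 := lt_of_le_not_ge hspec hcon
      have h2 := Order.coheight_add_one_le h1
      rw [P.2, Q.2] at h2
      exact absurd h2 (by decide)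
    exact hP ((Subtype.ext (hPQ'.antisymm hspec).eq : P = Q) ▸ hQ)
  · exact h (Set.mem_iUnion₂.mpr ⟨Q, hQ, subset_closure rfl⟩)

variable {X : Scheme.{u}} [IsIntegral X] [IsNoetherian X]

theorem div_apply (f : X.functionField) (P : PrimeDivisor X) : div f P = Scheme.ord f P.1 := rfl

theorem ord_inv {f : X.functionField} (hf : f ≠ 0) (x : X) :
    Scheme.ord f⁻¹ x = -Scheme.ord f x := by
  have h1 : Scheme.ord (1 : X.functionField) x = 0 := by
    have := Scheme.ord_mul (X := X) (x := x) (one_ne_zero (α := X.functionField)) one_ne_zero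
    rw [mul_one] at this
    linarith
  have h := Scheme.ord_mul (x := x) hf (inv_ne_zero hf)
  rw [mul_inv_cancel₀ hf, h1] at h
  linarith

variable (hX : ∀ x : X, IsIntegrallyClosed (X.presheaf.stalk x)) {F : X.Modules}

theorem smul_mem_stalkAt_iff_of_isDivisorOf {e : genericStalk F} {D : WeilDivisor X}
    (hD : IsDivisorOf F e D) (P : PrimeDivisor X) {f : X.functionField} (hf : f ≠ 0) :
    f • e ∈ stalkAt F P.1 ↔ 0 ≤ D P + Scheme.ord f P.1 := by
  constructor
  · rintro ⟨U, hU, m, hm⟩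
    have h : f ∈ lineSections F e (genericPoint_mem hU) := ⟨m, hm⟩
    rw [← hD U] at h
    exact h hf P hU
  · intro h
    -- Removing the finitely many prime divisors where `D + div f` is negative makes `f` a section
    -- of `𝒪_X(D)` near `P`.
    obtain ⟨U, hPU, hU⟩ := exists_open_primeDivisor_not_mem P
      (S := {Q | (D + div f) Q < 0}) ((D + div f).support.finite_toSet.subset fun Q hQ => by
        simpa using ne_of_lt hQ) (not_lt.mpr h)
    have hf' : f ∈ sectionsOfDivisor D U := fun _ Q hQ => by
      by_contra hcon
      exact hU Q (not_le.mp hcon) hQ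
    rw [hD U (genericPoint_mem hPU)] at hf'
    obtain ⟨m, hm⟩ := hf'
    exact ⟨U, hPU, m, hm⟩

include hX in
theorem isDivisorOf_unique {e : genericStalk F} {D D' : WeilDivisor X}
    (hD : IsDivisorOf F e D) (hD' : IsDivisorOf F e D') : D = D' := by
  have key : ∀ {D D' : WeilDivisor X}, IsDivisorOf F e D → IsDivisorOf F e D' → D ≤ D' := by
    intro D D' hD hD' P
    obtain ⟨f, hf, hfP⟩ := exists_ord_eq hX P (-D P)
    have h := (smul_mem_stalkAt_iff_of_isDivisorOf hD' P hf).mp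
      ((smul_mem_stalkAt_iff_of_isDivisorOf hD P hf).mpr (by omega))
    omega
  exact le_antisymm (key hD hD') (key hD' hD)

include hX in
/-- At a prime divisor, the fractions `f` with `f • e ∈ F_P` form a fractional ideal of the
discrete valuation ring, provided that it is neither zero nor everything. -/
theorem exists_smul_mem_stalkAt_iff (P : PrimeDivisor X) {e : genericStalk F}
    (lin : genericStalk F →ₗ[X.functionField] X.functionField) (hlin : lin e = 1)
    (h1 : ∃ r : X.functionField, r ≠ 0 ∧ r • e ∈ stalkAt F P.1)
    (h2 : ∃ r : X.functionField, r ≠ 0 ∧ ∀ v ∈ stalkAt F P.1, r * lin v ∈ regularAt P.1) :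
    ∃ n : ℤ, ∀ f : X.functionField, f ≠ 0 → (f • e ∈ stalkAt F P.1 ↔ 0 ≤ n + Scheme.ord f P.1) := by
  obtain ⟨r, hr, hre⟩ := h1
  obtain ⟨q, hq, hqe⟩ := h2
  -- The orders of the admissible multipliers: `r` shows that there is one, and `lin e = 1` together
  -- with `q` bounds them below. The coefficient is minus the least order.
  let S : Set ℤ := {n | ∃ f : X.functionField, f ≠ 0 ∧ f • e ∈ stalkAt F P.1 ∧
    Scheme.ord f P.1 = n}
  have hS : ∀ n ∈ S, -Scheme.ord q P.1 ≤ n := by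
    rintro _ ⟨f, hf, hfe, rfl⟩
    have := hqe _ hfe
    rw [map_smul, hlin, smul_eq_mul, mul_one, mem_regularAt_iff_ord_nonneg hX P
      (mul_ne_zero hq hf), Scheme.ord_mul hq hf] at this
    linarith
  obtain ⟨n, ⟨g, hg, hge, rfl⟩, hmin⟩ := Int.exists_least_of_bdd (P := (· ∈ S)) ⟨_, hS⟩
    ⟨_, r, hr, hre, rfl⟩
  refine ⟨-Scheme.ord g P.1, fun f hf => ⟨fun h => ?_, fun h => ?_⟩⟩
  · have := hmin _ ⟨f, hf, h, rfl⟩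
    linarith
  · have : f • e = (f * g⁻¹) • g • e := by
      rw [smul_smul, inv_mul_cancel_right₀ hg]
    rw [this]
    refine smul_mem_stalkAt ?_ hge
    rw [mem_regularAt_iff_ord_nonneg hX P (mul_ne_zero hf (inv_ne_zero hg)),
      Scheme.ord_mul hf (inv_ne_zero hg), ord_inv hg]
    linarith

include hX in
-- Stated for any `F` so as to serve both `E` and `E^∨`. The form `lin` is a coordinate along `e`;
-- `hF` is the Hartogs property, `h1` and `h2` make each coefficient finite, and `h3` makes almost
-- all of them zero.
theorem exists_isDivisorOf {e : genericStalk F}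
    (lin : genericStalk F →ₗ[X.functionField] X.functionField) (hlin : lin e = 1)
    (hF : ∀ (U : X.Opens) (hU : genericPoint X ∈ U) (v : genericStalk F),
      (∀ P : PrimeDivisor X, P.1 ∈ U → v ∈ stalkAt F P.1) → ∃ m : Γ(F, U), germ F hU m = v)
    (h1 : ∀ P : PrimeDivisor X, ∃ r : X.functionField, r ≠ 0 ∧ r • e ∈ stalkAt F P.1)
    (h2 : ∀ P : PrimeDivisor X, ∃ r : X.functionField, r ≠ 0 ∧
      ∀ v ∈ stalkAt F P.1, r * lin v ∈ regularAt P.1)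
    (h3 : ∃ U : X.Opens, genericPoint X ∈ U ∧ ∀ x ∈ U, e ∈ stalkAt F x ∧
      ∀ v ∈ stalkAt F x, lin v ∈ regularAt x) :
    ∃ D : WeilDivisor X, IsDivisorOf F e D := by
  choose n hn using fun P => exists_smul_mem_stalkAt_iff hX P lin hlin (h1 P) (h2 P)
  obtain ⟨U, hU, hUe⟩ := h3
  have hfin : (Function.support n).Finite := by
    refine (finite_primeDivisor_not_mem U ⟨_, hU⟩).subset fun P hP hPU => hP ?_
    -- For `P` in `U`, the function `f` of order `0` yields `n P ≥ 0`, and `g` of order `-n P`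
    -- yields `n P ≤ 0`.
    obtain ⟨f, hf, hfP⟩ := exists_ord_eq hX P 0
    obtain ⟨g, hg, hgP⟩ := exists_ord_eq hX P (-n P)
    have hfe := (hn P f hf).mp (smul_mem_stalkAt
      ((mem_regularAt_iff_ord_nonneg hX P hf).mpr hfP.ge) (hUe P.1 hPU).1)
    have hge := (hUe P.1 hPU).2 _ ((hn P g hg).mpr (by omega))
    rw [map_smul, hlin, smul_eq_mul, mul_one, mem_regularAt_iff_ord_nonneg hX P hg] at hge
    omega
  refine ⟨Finsupp.ofSupportFinite n hfin, fun V hV => Set.ext fun f => ?_⟩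
  by_cases hf : f = 0
  · subst hf
    exact ⟨fun _ => ⟨0, by rw [map_zero, zero_smul]⟩, fun _ h => absurd rfl h⟩
  constructor
  · intro h
    exact hF V hV _ fun P hP => (hn P f hf).mpr (h hf P hP)
  · rintro ⟨m, hm⟩ _ P hP
    exact (hn P f hf).mp (hm ▸ germ_mem_stalkAt hV hP m)

end Divisors

/-! ### The Weil decoration of the dual. -/

section WeilDecoration

variable {X : Scheme.{u}} [IsIntegral X] [IsNoetherian X]
  (hX : ∀ x : X, IsIntegrallyClosed (X.presheaf.stalk x)) {E : X.Modules} (hE : IsCoherent E)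

theorem divisorOf_spec {F : X.Modules} {e : genericStalk F} (h : ∃ D, IsDivisorOf F e D) :
    IsDivisorOf F e (divisorOf F e) :=
  Classical.epsilon_spec h

include hX hE

theorem exists_isDivisorOf_of_isReflexive (hrefl : IsReflexive E) {e : genericStalk E}
    (he : e ≠ 0) : ∃ D, IsDivisorOf E e D := by
  obtain ⟨φ, hφ⟩ := Module.Projective.exists_dual_eq_one X.functionField he
  refine exists_isDivisorOf hX φ hφ
    (fun U hU v => exists_germ_eq_of_forall_primeDivisor_of_isReflexive hX hE hrefl hU)
    (fun P => exists_smul_mem_stalkAt hE P.1 e) (fun P => ?_) ?_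
  · obtain ⟨r, hr, ψ, hψ, hψφ⟩ := exists_smul_dual_mem_stalkAt hE P.1 φ
    refine ⟨r, hr, fun v hv => ?_⟩
    rw [← smul_eq_mul, ← LinearMap.smul_apply, ← hψφ]
    exact canonicalDualMap_apply_mem_regularAt hψ hv
  · obtain ⟨ψ, rfl⟩ := (canonicalDualMap_bijective hE).2 φ
    obtain ⟨U, hU, hUe⟩ := exists_open_mem_stalkAt (mem_stalkAt_genericPoint e)
    obtain ⟨V, hV, hVψ⟩ := exists_open_mem_stalkAt (mem_stalkAt_genericPoint ψ)
    exact ⟨U ⊓ V, ⟨hU, hV⟩, fun x hx => ⟨hUe x hx.1, fun v hv =>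
      canonicalDualMap_apply_mem_regularAt (hVψ x hx.2) hv⟩⟩

/-- Vectors and forms exchange roles: the coordinate along `ψ` is evaluation at a vector `e` with
`ψ(e) = 1`. -/
theorem exists_isDivisorOf_dual {ψ : genericStalk (dual E)} (hψ : ψ ≠ 0) :
    ∃ D, IsDivisorOf (dual E) ψ D := by
  have hne : canonicalDualMap E ψ ≠ 0 :=
    (map_ne_zero_iff _ (canonicalDualMap_injective E)).mpr hψ
  obtain ⟨e, he⟩ : ∃ e, canonicalDualMap E ψ e = 1 := by
    obtain ⟨v, hv⟩ : ∃ v, canonicalDualMap E ψ v ≠ 0 := by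
      by_contra! h
      exact hne (LinearMap.ext h)
    exact ⟨(canonicalDualMap E ψ v)⁻¹ • v, by rw [map_smul, smul_eq_mul, inv_mul_cancel₀ hv]⟩
  refine exists_isDivisorOf hX ((LinearMap.applyₗ e).comp (canonicalDualMap E)) he
    (fun U hU v => exists_germ_dual_eq_of_forall_primeDivisor hX hU) (fun P => ?_) (fun P => ?_) ?_
  · obtain ⟨r, hr, χ, hχ, hχψ⟩ := exists_smul_dual_mem_stalkAt hE P.1 (canonicalDualMap E ψ)
    rw [← map_smul] at hχψ
    exact ⟨r, hr, canonicalDualMap_injective E hχψ ▸ hχ⟩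
  · obtain ⟨r, hr, hre⟩ := exists_smul_mem_stalkAt hE P.1 e
    refine ⟨r, hr, fun χ hχ => ?_⟩
    have := canonicalDualMap_apply_mem_regularAt hχ hre
    rwa [map_smul] at this
  · obtain ⟨U, hU, hUe⟩ := exists_open_mem_stalkAt (mem_stalkAt_genericPoint e)
    obtain ⟨V, hV, hVψ⟩ := exists_open_mem_stalkAt (mem_stalkAt_genericPoint ψ)
    exact ⟨U ⊓ V, ⟨hU, hV⟩, fun x hx => ⟨hVψ x hx.2, fun v hv =>
      canonicalDualMap_apply_mem_regularAt hv (hUe x hx.1)⟩⟩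

/-- The coefficient at `P` of the divisor of `ψ ∈ (E^∨)_η` is the minimum of the coefficients of
the differences `div(ψ(v)) - W_E(v)`. -/
theorem isLeast_divisorOf_dual (hrefl : IsReflexive E) {ψ : genericStalk (dual E)} (hψ : ψ ≠ 0)
    (P : PrimeDivisor X) :
    IsLeast {n : ℤ | ∃ v : genericStalk E, canonicalDualMap E ψ v ≠ 0 ∧
      n = (div (canonicalDualMap E ψ v) - divisorOf E v) P} (divisorOf (dual E) ψ P) := by
  have hD := divisorOf_spec (exists_isDivisorOf_dual hX hE hψ)
  have hW : ∀ {v : genericStalk E}, v ≠ 0 → IsDivisorOf E v (divisorOf E v) := fun hv =>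
    divisorOf_spec (exists_isDivisorOf_of_isReflexive hX hE hrefl hv)
  have hv0 : ∀ {v : genericStalk E}, canonicalDualMap E ψ v ≠ 0 → v ≠ 0 := by
    rintro v hv rfl
    exact hv (map_zero _)
  have hlower : ∀ v : genericStalk E, canonicalDualMap E ψ v ≠ 0 →
      divisorOf (dual E) ψ P ≤ (div (canonicalDualMap E ψ v) - divisorOf E v) P := by
    intro v hv
    -- With these orders `g • v` and `f • ψ` just lie in the stalks at `P`, and the regularity of
    -- their pairing is the inequality sought.
    obtain ⟨g, hg, hgP⟩ := exists_ord_eq hX P (-divisorOf E v P)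
    obtain ⟨f, hf, hfP⟩ := exists_ord_eq hX P (-divisorOf (dual E) ψ P)
    have hgv := (smul_mem_stalkAt_iff_of_isDivisorOf (hW (hv0 hv)) P hg).mpr (by omega)
    have hfψ := (smul_mem_stalkAt_iff_of_isDivisorOf hD P hf).mpr (by omega)
    have h := canonicalDualMap_apply_mem_regularAt hfψ hgv
    rw [map_smul, map_smul, LinearMap.smul_apply, smul_eq_mul, smul_eq_mul,
      mem_regularAt_iff_ord_nonneg hX P (mul_ne_zero hg (mul_ne_zero hf hv)),
      Scheme.ord_mul hg (mul_ne_zero hf hv), Scheme.ord_mul hf hv] at h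
    rw [Finsupp.sub_apply, div_apply]
    omega
  refine ⟨?_, ?_⟩
  · by_contra hcon
    have hlt : ∀ v : genericStalk E, canonicalDualMap E ψ v ≠ 0 →
        divisorOf (dual E) ψ P < (div (canonicalDualMap E ψ v) - divisorOf E v) P :=
      fun v hv => lt_of_le_of_ne (hlower v hv) fun h => hcon ⟨v, hv, h⟩
    -- If the bound were strict for every `v`, this `f`, of order one less than allowed, would still
    -- give `f • ψ` regular values on `E_P`. Then `f • ψ` would lie in the stalk of `E^∨`, against
    -- the definition of its coefficient at `P`.
    obtain ⟨f, hf, hfP⟩ := exists_ord_eq hX P (-divisorOf (dual E) ψ P - 1)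
    obtain ⟨χ, hχ, hχψ⟩ := (exists_mem_stalkAt_dual_iff hE (x := P.1)
      (f • canonicalDualMap E ψ)).mpr fun v hv => by
        rw [LinearMap.smul_apply, smul_eq_mul]
        by_cases hv' : canonicalDualMap E ψ v = 0
        · rw [hv', mul_zero]
          exact zero_mem _
        rw [mem_regularAt_iff_ord_nonneg hX P (mul_ne_zero hf hv'), Scheme.ord_mul hf hv']
        have h1 := hlt v hv'
        rw [Finsupp.sub_apply, div_apply] at h1
        -- Multiplying by a function of order `0` turns `v ∈ E_P` into `W_E(v)_P ≥ 0`.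
        obtain ⟨g, hg, hgP⟩ := exists_ord_eq hX P 0
        have h2 := (smul_mem_stalkAt_iff_of_isDivisorOf (hW (hv0 hv')) P hg).mp
          (smul_mem_stalkAt ((mem_regularAt_iff_ord_nonneg hX P hg).mpr hgP.ge) hv)
        omega
    rw [← map_smul] at hχψ
    have := (smul_mem_stalkAt_iff_of_isDivisorOf hD P hf).mp
      (canonicalDualMap_injective E hχψ ▸ hχ)
    omega
  · rintro _ ⟨v, hv, rfl⟩
    exact hlower v hv

theorem isGLB_weilDecoration_dual (hrefl : IsReflexive E) (ψ : genericStalk (dual E)) :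
    IsGLB (dualDifferences E (canonicalDualMap E ψ)) (weilDecoration (dual E) ψ) := by
  by_cases hψ : ψ = 0
  · subst hψ
    have h0 : weilDecoration (dual E) (0 : genericStalk (dual E)) = ⊤ := if_pos rfl
    rw [h0]
    refine ⟨?_, fun _ _ => le_top⟩
    rintro _ ⟨v, -, rfl⟩
    rw [map_zero, LinearMap.zero_apply, divTop, if_pos rfl, WithTop.top_add]
  have hleast := isLeast_divisorOf_dual hX hE hrefl hψ
  rw [weilDecoration, if_neg hψ]
  constructor
  · rintro _ ⟨v, hv, rfl⟩
    by_cases hv' : canonicalDualMap E ψ v = 0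
    · rw [divTop, if_pos hv', WithTop.top_add]
      exact le_top
    · rw [divTop, if_neg hv', ← WithTop.coe_add, WithTop.coe_le_coe]
      intro P
      rw [← sub_eq_add_neg]
      exact (hleast P).2 ⟨v, hv', rfl⟩
  · intro B hB
    have hmem : ∀ v : genericStalk E, canonicalDualMap E ψ v ≠ 0 →
        B ≤ ((div (canonicalDualMap E ψ v) - divisorOf E v : WeilDivisor X) :
          WithTop (WeilDivisor X)) := by
      intro v hv
      refine hB ⟨v, ?_, ?_⟩
      · rintro rfl
        exact hv (map_zero _)
      · rw [divTop, if_neg hv, ← WithTop.coe_add, sub_eq_add_neg]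
    obtain ⟨v, hv⟩ : ∃ v, canonicalDualMap E ψ v ≠ 0 := by
      by_contra! h
      exact hψ (canonicalDualMap_injective E ((LinearMap.ext h).trans (map_zero _).symm))
    -- Some value of `ψ` is nonzero, so a lower bound is an honest divisor and can be compared
    -- coefficient by coefficient. The minimizing vector `w` may depend on `P`.
    obtain ⟨B, rfl⟩ := WithTop.ne_top_iff_exists.mp
      (ne_top_of_le_ne_top WithTop.coe_ne_top (hmem v hv))
    rw [WithTop.coe_le_coe]
    intro P
    obtain ⟨w, hw, hwP⟩ := (hleast P).1
    rw [hwP]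
    exact WithTop.coe_le_coe.mp (hmem w hw) P

end WeilDecoration

end

end WeilDeco

open WeilDeco
theorem mainTheorem6 {k : Type u} [Field k] [IsAlgClosed k] [CharZero k] (X : NormalVariety k)
    (E : X.X.Modules) (hcoh : IsCoherent E) (hrefl : IsReflexive E) :
    -- the Weil decorations of `E` and of `E^∨` are well defined
    (∀ e : genericStalk E, e ≠ 0 → ∃! D, IsDivisorOf E e D) ∧
    (∀ e : genericStalk (dual E), e ≠ 0 → ∃! D, IsDivisorOf (dual E) e D) ∧
    -- under the canonical isomorphism `(E^∨)_η ≅ (E_η)^∨`, `W_{E^∨}(φ)` is the meet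
    ∃ c : genericStalk (dual E) ≃ₗ[X.X.functionField]
        Module.Dual X.X.functionField (genericStalk E),
      IsCanonicalDualIso E c ∧
      (∀ φ : Module.Dual X.X.functionField (genericStalk E),
        IsGLB (dualDifferences E φ) (weilDecoration (dual E) (c.symm φ))) ∧
      -- and for `φ ≠ 0` this meet is a divisor, taken coefficientwise
      (∀ φ : Module.Dual X.X.functionField (genericStalk E), φ ≠ 0 →
        ∃ D : WeilDivisor X.X, weilDecoration (dual E) (c.symm φ) = D ∧
          ∀ P : PrimeDivisor X.X,
            IsLeast {n : ℤ | ∃ v : genericStalk E, φ v ≠ 0 ∧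
              n = (div (φ v) - divisorOf E v) P} (D P)) := by
  have hX := X.isIntegrallyClosed_stalk
  refine ⟨fun e he => ?_, fun ψ hψ => ?_,
    LinearEquiv.ofBijective (canonicalDualMap E) (canonicalDualMap_bijective hcoh), ?_, ?_, ?_⟩
  · obtain ⟨D, hD⟩ := exists_isDivisorOf_of_isReflexive hX hcoh hrefl he
    exact ⟨D, hD, fun D' hD' => isDivisorOf_unique hX hD' hD⟩
  · obtain ⟨D, hD⟩ := exists_isDivisorOf_dual hX hcoh hψ
    exact ⟨D, hD, fun D' hD' => isDivisorOf_unique hX hD' hD⟩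
  · intro U V hU hV h s m
    rw [LinearEquiv.ofBijective_apply, canonicalDualMap_germ, inducedForm_germ E hU s h hV]
  · intro φ
    -- Writing `φ` as the image of `ψ` removes the inverse isomorphism from the statement.
    obtain ⟨ψ, rfl⟩ := (canonicalDualMap_bijective hcoh).2 φ
    rw [← LinearEquiv.ofBijective_apply (canonicalDualMap E) (hf := canonicalDualMap_bijective hcoh),
      LinearEquiv.symm_apply_apply]
    exact isGLB_weilDecoration_dual hX hcoh hrefl ψ
  · intro φ hφ
    obtain ⟨ψ, rfl⟩ := (canonicalDualMap_bijective hcoh).2 φ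
    have hψ : ψ ≠ 0 := by
      rintro rfl
      exact hφ (map_zero _)
    refine ⟨divisorOf (dual E) ψ, ?_, isLeast_divisorOf_dual hX hcoh hrefl hψ⟩
    rw [← LinearEquiv.ofBijective_apply (canonicalDualMap E) (hf := canonicalDualMap_bijective hcoh),
      LinearEquiv.symm_apply_apply, weilDecoration, if_neg hψ]
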